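/- Let $n\ge 0$. A diagram is a subset $D$ of the boxes of the $n\times n$ grid (rows numbered from top to bottom); write $D=(D_1,\dots,D_n)$, where $D_j\subseteq[n]$ is the set of rows of the boxes in column $j$. *Multiplicity-free.* For an ordered pair $(P,Q)$ of subsets of $[n]$ consider the following six configurations. In each of them one asks for row indices $i_1<i_2<i_3$, respectively $i_1<i_2<i_3<i_4$, in $[n]$ with (A) $i_1\notin P,\ i_1\notin Q;\ i_2\in P,\ i_2\notin Q;\ i_3\in Q$; (B) $i_1\notin P,\ i_1\in Q;\ i_2\notin P,\ i_2\notin Q;\ i_3\in P,\ i_3\in Q;\ i_4\in P$; (C) $i_1\notin P,\ i_1\notin Q;\ i_2\notin P,\ i_2\notin Q;\ i_3\in P,\ i_3\in Q;\ i_4\in P$; (D) $i_1\notin P,\ i_1\in Q;\ i_2\in P,\ i_2\notin Q;\ i_3\in P,\ i_3\in Q$; (E) $i_1\notin P,\ i_1\in Q;\ i_2\in P,\ i_2\notin Q;\ i_3\in P,\ i_3\notin Q;\ i_4\notin P,\ i_4\in Q$; (F) $i_1\in P,\ i_1\notin Q;\ i_2\notin P,\ i_2\in Q;\ i_3\in P,\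 i_3\notin Q;\ i_4\notin P,\ i_4\in Q$. $D$ is multiplicity-free if for no $j\neq j'$ the pair $(D_j,D_{j'})$ contains one of these configurations. *Normalized.* For $S\subseteq[n]$ list the elements of $([n]\setminus S)\cup\{\infty\}$ increasingly, and let $S\prec T$ mean that the list of $S$ is lexicographically smaller than the list of $T$. $D$ is normalized if its columns are weakly increasing from left to right with respect to $\prec$, that is, $D_j=D_{j'}$ or $D_j\prec D_{j'}$ for $j<j'$. *Gale order.* For $R,S\subseteq[n]$ let $R\le S$ mean that $R=\{r_1<\dots<r_k\}$ and $S=\{s_1<\dots<s_k\}$ have the same size and $r_i\le s_i$ for all $i$. For diagrams, $C\le D$ means $C_j\le D_j$ for all $j$. Put $x^C=\prod_j\prod_{i\in C_j}x_i$. *Flagged fillings.* A flagged filling $F$ of $D$ puts a positive integer $c_{ij}\le i$ into each box $(i,j)\in D$, such that the entries in each column are distinct. Let $\mathrm{inv}(F)$ be the sum over the columns of the number of inversions of the word read from top to bottom, $\mathrm{sgn}(F)=(-1)^{\mathrm{inv}(F)}$, and let the weight of $F$ be the monomial $y^F=\prod_{(i,j)\in D}y_{c_{ij}\,i}$. For $C\le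 D$ let $\mathcal F_D(C)$ be the set of flagged fillings of $D$ whose set of entries in column $j$ is $C_j$, for all $j$. *Flagged Weyl module.* Let $Y$ be the upper-triangular $n\times n$ matrix of variables $y_{ij}$, $i\le j$, and let $\mathbb C[Y]$ be the polynomial ring in these variables. For $C\le D$ put $\det(Y_D^C)=\prod_{j=1}^n\det(Y_{D_j}^{C_j})$, where $Y_S^R$ is the submatrix of $Y$ with rows $R$ and columns $S$, and let $\mathcal M_D=\mathrm{Span}_{\mathbb C}\{\det(Y_D^C):C\le D\}\subseteq\mathbb C[Y]$. An invertible upper-triangular matrix $b$ over $\mathbb C$ acts by $f(Y)\mapsto f(b^{-1}Y)$. For a function $\chi:(\mathbb C^\times)^n\to\mathbb C$ the $\chi$-eigenspace of $\mathcal M_D$ is the space of all $f\in\mathcal M_D$ on which each diagonal matrix $X=\mathrm{diag}(x_1,\dots,x_n)$ with $x_i\in\mathbb C^\times$ acts as multiplication by $\chi(x_1,\dots,x_n)$. **Theorem.** Let $D$ be a normalized multiplicity-free diagram. (1) If $C,C'\le D$ are diagrams with $x^C=x^{C'}$, then there is a bijection $\varphi:\mathcal F_D(C)\to\mathcal F_D(C')$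 with $\mathrm{sgn}(\varphi(F))=\mathrm{sgn}(F)$ and $y^{\varphi(F)}=y^F$ for all $F\in\mathcal F_D(C)$; moreover $\det(Y_D^C)=\det(Y_D^{C'})$. (2) For each $C\le D$, the eigenspace of $\mathcal M_D$ for the eigenvalue $\prod_j\prod_{i\in C_j}x_i^{-1}$ equals $\mathrm{Span}_{\mathbb C}\{\det(Y_D^{C'}):C'\le D,\ x^{C'}=x^C\}$ and has dimension one. (3) Each nonzero eigenspace of $\mathcal M_D$ has dimension one. -/

import Mathlib

noncomputable section

namespace FlaggedWeyl

open MvPolynomial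

/-- A diagram in the `n × n` grid, given by its columns: `i ∈ D j` means that the box in row `i` and
column `j` belongs to `D`. Rows and columns are numbered from `0` to `n - 1`. -/
abbrev Diagram (n : ℕ) := Fin n → Finset (Fin n)

/-- The six multiplicitous configurations, for an ordered pair `(P, Q)` of columns. Each line below
describes one row, from top to bottom. The configurations `A` and `D` are drawn with a fourth row that
carries no restriction at all (and that may lie below the grid); it is left out here. -/
def MultiplicitousPair {n : ℕ} (P Q : Finset (Fin n)) : Prop :=
  -- configuration A
  (∃ i₁ i₂ i₃ : Fin n, i₁ < i₂ ∧ i₂ < i₃ ∧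
    (i₁ ∉ P ∧ i₁ ∉ Q) ∧
    (i₂ ∈ P ∧ i₂ ∉ Q) ∧
    i₃ ∈ Q) ∨
  -- configuration B
  (∃ i₁ i₂ i₃ i₄ : Fin n, i₁ < i₂ ∧ i₂ < i₃ ∧ i₃ < i₄ ∧
    (i₁ ∉ P ∧ i₁ ∈ Q) ∧
    (i₂ ∉ P ∧ i₂ ∉ Q) ∧
    (i₃ ∈ P ∧ i₃ ∈ Q) ∧
    i₄ ∈ P) ∨
  -- configuration C
  (∃ i₁ i₂ i₃ i₄ : Fin n, i₁ < i₂ ∧ i₂ < i₃ ∧ i₃ < i₄ ∧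
    (i₁ ∉ P ∧ i₁ ∉ Q) ∧
    (i₂ ∉ P ∧ i₂ ∉ Q) ∧
    (i₃ ∈ P ∧ i₃ ∈ Q) ∧
    i₄ ∈ P) ∨
  -- configuration D
  (∃ i₁ i₂ i₃ : Fin n, i₁ < i₂ ∧ i₂ < i₃ ∧
    (i₁ ∉ P ∧ i₁ ∈ Q) ∧
    (i₂ ∈ P ∧ i₂ ∉ Q) ∧
    (i₃ ∈ P ∧ i₃ ∈ Q)) ∨
  -- configuration E
  (∃ i₁ i₂ i₃ i₄ : Fin n, i₁ < i₂ ∧ i₂ < i₃ ∧ i₃ < i₄ ∧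
    (i₁ ∉ P ∧ i₁ ∈ Q) ∧
    (i₂ ∈ P ∧ i₂ ∉ Q) ∧
    (i₃ ∈ P ∧ i₃ ∉ Q) ∧
    (i₄ ∉ P ∧ i₄ ∈ Q)) ∨
  -- configuration F
  (∃ i₁ i₂ i₃ i₄ : Fin n, i₁ < i₂ ∧ i₂ < i₃ ∧ i₃ < i₄ ∧
    (i₁ ∈ P ∧ i₁ ∉ Q) ∧
    (i₂ ∉ P ∧ i₂ ∈ Q) ∧
    (i₃ ∈ P ∧ i₃ ∉ Q) ∧
    (i₄ ∉ P ∧ i₄ ∈ Q))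

/-- No two distinct columns, in either order, contain a multiplicitous configuration. -/
def MultiplicityFree {n : ℕ} (D : Diagram n) : Prop :=
  ∀ j j' : Fin n, j ≠ j' → ¬ MultiplicitousPair (D j) (D j')

/-- The missing rows of a column in increasing order, followed by `∞`. -/
def crossings {n : ℕ} (S : Finset (Fin n)) : List (WithTop (Fin n)) :=
  Sᶜ.sort.map (fun i => (i : WithTop (Fin n))) ++ [⊤]

/-- The order `≺` on columns: lexicographic comparison of the lists of crossings. -/
def ColumnPrec {n : ℕ} (S T : Finset (Fin n)) : Prop :=
  List.Lex (· < ·) (crossings S) (crossings T)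

/-- The columns are arranged increasingly from left to right with respect to `≺`
(equal columns may be repeated). -/
def Normalized {n : ℕ} (D : Diagram n) : Prop :=
  ∀ j j' : Fin n, j < j' → D j = D j' ∨ ColumnPrec (D j) (D j')

/-- The Gale order on sets of rows: `R` and `S` have the same cardinality, and the `a`-th smallest
element of `R` is at most the `a`-th smallest element of `S`, for every `a`. -/
def GaleLE {n : ℕ} (R S : Finset (Fin n)) : Prop :=
  ∃ h : R.card = S.card, ∀ a : Fin S.card, R.orderEmbOfFin h a ≤ S.orderEmbOfFin rfl a

/-- The Gale order on diagrams, column by column. -/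
def DiagramLE {n : ℕ} (C D : Diagram n) : Prop := ∀ j, GaleLE (C j) (D j)

/-- The monomial `x^C = ∏_j ∏_{i ∈ C_j} x_i`. -/
def xMonomial {n : ℕ} (C : Diagram n) : MvPolynomial (Fin n) ℂ :=
  ∏ j, ∏ i ∈ C j, X i

/-- The positions `(i, j)` with `i ≤ j`, which index the variables `y_{ij}`. -/
abbrev UpperIndex (n : ℕ) := {p : Fin n × Fin n // p.1 ≤ p.2}

/-- The ring `ℂ[Y]` of polynomials in the variables `y_{ij}`, `i ≤ j`. -/
abbrev PolyY (n : ℕ) := MvPolynomial (UpperIndex n) ℂ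

/-- The upper-triangular matrix `Y` of variables. -/
def matrixY (n : ℕ) : Matrix (Fin n) (Fin n) (PolyY n) :=
  Matrix.of fun i j => if h : i ≤ j then X ⟨(i, j), h⟩ else 0

/-- `det (Y^R_S)`: the minor of `Y` on rows `R` and columns `S`, for sets of the same size. -/
def columnMinor {n : ℕ} (R S : Finset (Fin n)) (h : R.card = S.card) : PolyY n :=
  ((matrixY n).submatrix (R.orderEmbOfFin h) (S.orderEmbOfFin rfl)).det

theorem GaleLE.card_eq {n : ℕ} {R S : Finset (Fin n)} (h : GaleLE R S) : R.card = S.card :=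
  h.1

/-- `det (Y_D^C) = ∏_j det (Y^{C_j}_{D_j})`, for `C ≤ D`. -/
def detY {n : ℕ} {C D : Diagram n} (h : DiagramLE C D) : PolyY n :=
  ∏ j, columnMinor (C j) (D j) (h j).card_eq

/-- The flagged Weyl module `M_D`, as a subspace of `ℂ[Y]`. -/
def weylModule {n : ℕ} (D : Diagram n) : Submodule ℂ (PolyY n) :=
  Submodule.span ℂ {f | ∃ (C : Diagram n) (h : DiagramLE C D), detY h = f}

/-- The action of an invertible upper-triangular matrix `b` on `ℂ[Y]`: `f(Y) ↦ f(b⁻¹ Y)`.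
(For such `b` the matrix `b⁻¹ Y` is upper-triangular, so its entries `(i, j)` with `i ≤ j`
are all that has to be substituted.) -/
def borelAction {n : ℕ} (b : GL (Fin n) ℂ) : PolyY n →ₐ[ℂ] PolyY n :=
  aeval fun p : UpperIndex n =>
    (((b⁻¹ : GL (Fin n) ℂ) : Matrix (Fin n) (Fin n) ℂ).map (C : ℂ → PolyY n) * matrixY n)
      p.1.1 p.1.2

/-- The invertible diagonal matrix with diagonal entries `x_1, …, x_n`. -/
def diagonalGL {n : ℕ} (x : Fin n → ℂˣ) : GL (Fin n) ℂ where
  val := Matrix.diagonal fun i => (x i : ℂ)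
  inv := Matrix.diagonal fun i => ((x i)⁻¹ : ℂˣ)
  val_inv := by simp [Matrix.diagonal_mul_diagonal]
  inv_val := by simp [Matrix.diagonal_mul_diagonal]

/-- The eigenspace of the diagonal matrices on `M_D` with eigenvalue `χ`: the `f ∈ M_D` such that each
invertible diagonal matrix `X = diag(x_1, …, x_n)` maps `f` to `χ(x_1, …, x_n) f`. -/
def weylEigenspace {n : ℕ} (D : Diagram n) (χ : (Fin n → ℂˣ) → ℂ) : Submodule ℂ (PolyY n) :=
  weylModule D ⊓
    ⨅ x : Fin n → ℂˣ, Module.End.eigenspace (borelAction (diagonalGL x)).toLinearMap (χ x)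

/-- The eigenvalue `∏_j ∏_{i ∈ C_j} x_i⁻¹` that belongs to a diagram `C`. -/
def eigenvalueOf {n : ℕ} (C : Diagram n) (x : Fin n → ℂˣ) : ℂ :=
  ∏ j, ∏ i ∈ C j, (x i : ℂ)⁻¹

/-- `Span {det (Y_D^{C'}) : C' ≤ D, x^{C'} = m}`. -/
def detSpan {n : ℕ} (D : Diagram n) (m : MvPolynomial (Fin n) ℂ) : Submodule ℂ (PolyY n) :=
  Submodule.span ℂ
    {f | ∃ (C' : Diagram n) (h : DiagramLE C' D), xMonomial C' = m ∧ detY h = f}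

/-- A flagged filling of `D`: `entry j i` is the entry in the box in row `i` of column `j`. The entries
in each column are distinct, and the entry of a box does not exceed the row of the box. (Entries are
shifted by one, like the rows, so the positive integers `1, …, n` are the elements of `Fin n`.) -/
@[ext]
structure FlaggedFilling {n : ℕ} (D : Diagram n) where
  entry : ∀ j : Fin n, ↥(D j) → Fin n
  injective : ∀ j, Function.Injective (entry j)
  flagged : ∀ j (i : ↥(D j)), entry j i ≤ i.1

namespace FlaggedFilling

variable {n : ℕ} {D : Diagram n}

/-- The number of inversions of column `j`, read from top to bottom. -/
def invColumn (F : FlaggedFilling D) (j : Fin n) : ℕ :=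
  Nat.card {p : ↥(D j) × ↥(D j) // p.1 < p.2 ∧ F.entry j p.1 > F.entry j p.2}

/-- The inversion number. -/
def inv (F : FlaggedFilling D) : ℕ := ∑ j, F.invColumn j

/-- The sign `(-1)^inv(F)`. -/
def sgn (F : FlaggedFilling D) : ℤ := (-1) ^ F.inv

/-- The weight `y^F`, the product of the variables `y_{c i}` over the boxes `(i, j)`, where `c` is the
entry in the box. -/
def weight (F : FlaggedFilling D) : PolyY n :=
  ∏ j, ∏ i : ↥(D j), X ⟨(F.entry j i, i.1), F.flagged j i⟩

end FlaggedFilling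

/-- `F_D(C)`: the flagged fillings of `D` whose set of entries in column `j` is `C_j`, for every `j`. -/
def fillings {n : ℕ} (D C : Diagram n) : Set (FlaggedFilling D) :=
  {F | ∀ j, Set.range (F.entry j) = (C j : Set (Fin n))}

end FlaggedWeyl

end

open FlaggedWeyl

namespace FlaggedWeyl

open MvPolynomial

/-! Write `cnt S k` for the number of elements of `S` in the first `k` rows. For sets of equal size,
`R ≤ S` in the Gale order means `cnt S k ≤ cnt R k` for all `k` (`galeLE_iff_cnt`). Call a column `C
a` balanced at `k` if `cnt (C a) k = cnt (D a) k`. In a flagged filling the boxes before row `k`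
hold entries smaller than `k`; at a balanced cut they hold all of these entries, so the filling
splits there into independent parts (`ent_lt_iff`). Suppose two columns of `D` coincide in the rows
`[s, t)` and the corresponding columns of `C` are both balanced at `s` and `t`. Then swapping these
rows between the two columns, in `C` and in each of its fillings, only permutes boxes within each
row and moves no inversion across a cut: signs and weights survive (`IsExchange.fillingsMatch`).

The combinatorial core is `exists_exchangeable`. Let `C` and `C'` have the same monomial and agree
before row `i`. If they differ in row `i`, equality of the row counts gives two columns in which
they differ in opposite ways. The absence of the six configurations then forces such a swap, in `C`
or in `C'`, that acts on row `i` and leaves the earlier rows unchanged. Each swap decreases the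
number of columns with a discrepancy in row `i`, so that `C` and `C'` are joined row by row
(`fillingsMatch_of_agree`).

The Leibniz expansion writes `detY` as the signed sum of the weights of the fillings
(`detY_eq_sum`), so a matching of fillings gives equal determinants. Finally, `detY` is homogeneous
for the grading of `ℂ[Y]` by row indices, with degree the exponent of `x^C`. Distinct degrees give
distinct characters of the torus, so the eigenspaces are the graded pieces of the module. Each
nonzero one is spanned by a single determinant, which is nonzero because it takes the value 1 at a
suitable 0-1 matrix. -/

/-- The number of elements of `S` in rows above the row `k`. -/
def cnt {n : ℕ} (S : Finset (Fin n)) (k : ℕ) : ℕ := (S.filter fun i => i.val < k).card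

/-! ### Counting functions and the Gale order. -/

section Counting

variable {n : ℕ} {R S : Finset (Fin n)} {k l : ℕ}

theorem cnt_le_card (S : Finset (Fin n)) (k : ℕ) : cnt S k ≤ S.card :=
  Finset.card_filter_le _ _

theorem cnt_eq_card_of_forall_lt (h : ∀ i ∈ S, i.val < k) : cnt S k = S.card := by
  rw [cnt, Finset.filter_true_of_mem h]

theorem cnt_size (S : Finset (Fin n)) : cnt S n = S.card :=
  cnt_eq_card_of_forall_lt fun i _ => i.isLt

theorem cnt_congr (h : ∀ i : Fin n, i.val < k → (i ∈ R ↔ i ∈ S)) : cnt R k = cnt S k := by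
  unfold cnt
  congr 1
  ext i
  simp only [Finset.mem_filter]
  constructor
  · rintro ⟨h1, h2⟩; exact ⟨(h i h2).1 h1, h2⟩
  · rintro ⟨h1, h2⟩; exact ⟨(h i h2).2 h1, h2⟩

theorem cnt_add (S : Finset (Fin n)) (h : k ≤ l) :
    cnt S l = cnt S k + (S.filter fun i => k ≤ i.val ∧ i.val < l).card := by
  unfold cnt
  rw [← Finset.card_union_of_disjoint]
  · congr 1
    ext i
    simp only [Finset.mem_filter, Finset.mem_union]
    constructor
    · rintro ⟨h1, h2⟩
      by_cases h3 : i.val < k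
      · exact Or.inl ⟨h1, h3⟩
      · exact Or.inr ⟨h1, by omega, h2⟩
    · rintro (⟨h1, h2⟩ | ⟨h1, h2, h3⟩)
      · exact ⟨h1, by omega⟩
      · exact ⟨h1, h3⟩
  · rw [Finset.disjoint_left]
    intro i h1 h2
    simp only [Finset.mem_filter] at h1 h2
    omega

theorem cnt_add_one_le {i : Fin n} (hi : i ∈ S) (hk : k ≤ i.val) (hl : i.val < l) :
    cnt S k + 1 ≤ cnt S l := by
  rw [cnt_add S (hk.trans hl.le)]
  have : 0 < (S.filter fun i => k ≤ i.val ∧ i.val < l).card :=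
    Finset.card_pos.2 ⟨i, by simp [hi, hk, hl]⟩
  omega

theorem cnt_succ_of_mem {i : Fin n} (hi : i ∈ S) : cnt S (i.val + 1) = cnt S i.val + 1 := by
  rw [cnt_add S (Nat.le_succ i.val)]
  congr 1
  rw [Finset.card_eq_one]
  refine ⟨i, ?_⟩
  ext x
  simp only [Finset.mem_filter, Finset.mem_singleton, Fin.ext_iff]
  constructor
  · rintro ⟨-, h1, h2⟩; omega
  · intro h
    have : x = i := Fin.ext h
    subst this
    exact ⟨hi, by omega, by omega⟩

theorem cnt_eq_of_forall (h : k ≤ l) (hS : ∀ i ∈ S, k ≤ i.val → ¬ i.val < l) :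
    cnt S l = cnt S k := by
  rw [cnt_add S h, Finset.filter_false_of_mem, Finset.card_empty, add_zero]
  rintro i hi ⟨h1, h2⟩
  exact hS i hi h1 h2

theorem cnt_succ_of_notMem {i : Fin n} (hi : i ∉ S) : cnt S (i.val + 1) = cnt S i.val := by
  refine cnt_eq_of_forall (Nat.le_succ _) fun x hx h1 h2 => hi ?_
  have : x = i := Fin.ext (by omega)
  exact this ▸ hx

theorem exists_mem_of_cnt_lt (h : k ≤ l) (hS : cnt S k < cnt S l) :
    ∃ i ∈ S, k ≤ i.val ∧ i.val < l := by
  by_contra hcon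
  push Not at hcon
  have := cnt_eq_of_forall (S := S) h fun i hi h1 h2 => absurd h2 (not_lt.2 (hcon i hi h1))
  omega

theorem eq_of_cnt_le_add_one {x y : Fin n} (h : cnt S l ≤ cnt S k + 1) (hx : x ∈ S) (hy : y ∈ S)
    (hkx : k ≤ x.val) (hxl : x.val < l) (hky : k ≤ y.val) (hyl : y.val < l) : x = y := by
  rcases lt_trichotomy x.val y.val with hlt | heq | hgt
  · have h1 := cnt_add_one_le (k := k) (l := y.val) hx hkx hlt
    have h2 := cnt_add_one_le hy le_rfl hyl
    omega
  · exact Fin.ext heq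
  · have h1 := cnt_add_one_le (k := k) (l := x.val) hy hky hgt
    have h2 := cnt_add_one_le hx le_rfl hxl
    omega

theorem cnt_compl (S : Finset (Fin n)) (h : k ≤ n) : cnt S k + cnt Sᶜ k = k := by
  induction k with
  | zero => simp [cnt]
  | succ k ih =>
    have ih := ih (by omega)
    by_cases hk : (⟨k, by omega⟩ : Fin n) ∈ S
    · have h1 := cnt_succ_of_mem hk
      have h2 := cnt_succ_of_notMem (S := Sᶜ) (i := ⟨k, by omega⟩) (by simpa using hk)
      simp only at h1 h2
      omega
    · have h1 := cnt_succ_of_notMem hk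
      have h2 := cnt_succ_of_mem (S := Sᶜ) (i := ⟨k, by omega⟩) (by simpa using hk)
      simp only at h1 h2
      omega

theorem cnt_eq_self_iff (h : k ≤ n) : cnt S k = k ↔ ∀ i : Fin n, i.val < k → i ∈ S := by
  have hc := cnt_compl S h
  constructor
  · intro hk i hi
    by_contra hiS
    have := cnt_add_one_le (S := Sᶜ) (k := 0) (by simpa using hiS) (Nat.zero_le _) hi
    omega
  · intro hS
    have := cnt_eq_of_forall (S := Sᶜ) (Nat.zero_le k)
      fun i hi _ h2 => (Finset.mem_compl.1 hi) (hS i h2)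
    have h0 : cnt Sᶜ 0 = 0 := by simp [cnt]
    omega

theorem cnt_add_one_le_self {x : Fin n} (h : k ≤ n) (hx : x ∉ S) (hxk : x.val < k) :
    cnt S k + 1 ≤ k := by
  have hc := cnt_compl S h
  have := cnt_add_one_le (S := Sᶜ) (k := 0) (by simpa using hx) (Nat.zero_le _) hxk
  omega

theorem mem_of_le_cnt_add_one {x y : Fin n} (h : k ≤ n) (hx : x ∉ S) (hxk : x.val < k)
    (hk : k ≤ cnt S k + 1) (hyk : y.val < k) (hy : y ≠ x) : y ∈ S := by
  by_contra hyS
  have hc := cnt_compl S h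
  refine hy (eq_of_cnt_le_add_one (S := Sᶜ) (k := 0) (l := k) (by omega) (by simpa using hyS)
    (by simpa using hx) (Nat.zero_le _) hyk (Nat.zero_le _) hxk)

/-- If `x` is the only element of `[k]` that is not in `S`, then `S` has `k - 1` elements there. -/
theorem cnt_add_one_eq_self {x : Fin n} (h : k ≤ n) (hx : x ∉ S) (hxk : x.val < k)
    (hS : ∀ y : Fin n, y.val < k → y ≠ x → y ∈ S) : cnt S k + 1 = k := by
  have h1 := cnt_add_one_le_self h hx hxk
  have hc := cnt_compl S h
  have h2 : cnt Sᶜ k ≤ 1 := by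
    refine Finset.card_le_one.2 fun a ha b hb => ?_
    simp only [Finset.mem_filter, Finset.mem_compl] at ha hb
    have ha' : a = x := by
      by_contra hne; exact ha.1 (hS a ha.2 hne)
    have hb' : b = x := by
      by_contra hne; exact hb.1 (hS b hb.2 hne)
    rw [ha', hb']
  omega

theorem cnt_eq_card_orderEmbOfFin {m : ℕ} (h : S.card = m) (k : ℕ) :
    cnt S k = (Finset.univ.filter fun a : Fin m => (S.orderEmbOfFin h a).val < k).card := by
  unfold cnt
  conv_lhs => rw [← Finset.map_orderEmbOfFin_univ S h]
  rw [Finset.filter_map, Finset.card_map]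
  rfl

/-- Moving elements to earlier rows can only increase the counts. In this form the Gale order
becomes a family of linear inequalities. -/
theorem galeLE_iff_cnt : GaleLE R S ↔ R.card = S.card ∧ ∀ k, cnt S k ≤ cnt R k := by
  constructor
  · rintro ⟨h, hle⟩
    refine ⟨h, fun k => ?_⟩
    rw [cnt_eq_card_orderEmbOfFin h, cnt_eq_card_orderEmbOfFin (S := S) rfl]
    refine Finset.card_le_card fun a ha => ?_
    simp only [Finset.mem_filter, Finset.mem_univ, true_and] at ha ⊢
    exact lt_of_le_of_lt (hle a) ha
  · rintro ⟨h, hle⟩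
    refine ⟨h, fun a => ?_⟩
    by_contra hlt
    push Not at hlt
    -- The threshold just past the `a`-th element of `S` (from 0): if that of `R` came later, `S`
    -- would have at least `a + 1` elements before the threshold and `R` at most `a`.
    have hk := hle ((S.orderEmbOfFin rfl a).val + 1)
    rw [cnt_eq_card_orderEmbOfFin h, cnt_eq_card_orderEmbOfFin (S := S) rfl] at hk
    have h1 : Finset.Iic a ⊆ Finset.univ.filter fun b : Fin S.card =>
        (S.orderEmbOfFin rfl b).val < (S.orderEmbOfFin rfl a).val + 1 := by
      intro b hb
      simp only [Finset.mem_filter, Finset.mem_univ, true_and]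
      have : S.orderEmbOfFin rfl b ≤ S.orderEmbOfFin rfl a :=
        (S.orderEmbOfFin rfl).monotone (Finset.mem_Iic.1 hb)
      exact Nat.lt_succ_of_le this
    have h2 : (Finset.univ.filter fun b : Fin S.card =>
        (R.orderEmbOfFin h b).val < (S.orderEmbOfFin rfl a).val + 1) ⊆ Finset.Iio a := by
      intro b hb
      simp only [Finset.mem_filter, Finset.mem_univ, true_and] at hb
      rw [Finset.mem_Iio]
      by_contra hba
      have h3 : R.orderEmbOfFin h a ≤ R.orderEmbOfFin h b :=
        (R.orderEmbOfFin h).monotone (not_lt.1 hba)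
      have h4 : (S.orderEmbOfFin rfl a).val < (R.orderEmbOfFin h a).val := hlt
      have h5 : (R.orderEmbOfFin h a).val ≤ (R.orderEmbOfFin h b).val := h3
      omega
    have h3 := Finset.card_le_card h1
    have h4 := Finset.card_le_card h2
    rw [Fin.card_Iic] at h3
    rw [Fin.card_Iio] at h4
    omega

theorem exists_first {p : Fin n → Prop} (h : ∃ x, p x) : ∃ x, p x ∧ ∀ y < x, ¬ p y := by
  obtain ⟨x, hx, hmin⟩ := WellFounded.has_min (wellFounded_lt (α := Fin n)) {x | p x} h
  exact ⟨x, hx, fun y hy hpy => hmin y hpy hy⟩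

/-- If `i` can be missing from a set below `S` in the Gale order, then `S` has a first gap,
which lies weakly above `i`. -/
theorem GaleLE.exists_gap {i : Fin n} (h : GaleLE R S) (hi : i ∉ R) :
    ∃ x ≤ i, x ∉ S ∧ ∀ y < x, y ∈ S := by
  have hex : ∃ x, x ∉ S ∧ x ≤ i := by
    by_contra hcon
    push Not at hcon
    -- If `S` contained all rows up to `i`, the counts would force the same for `R`, which misses
    -- `i`.
    have hall : ∀ x : Fin n, x.val < i.val + 1 → x ∈ S := by
      intro x hx
      by_contra hxS
      have h3 : i.val < x.val := hcon x hxS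
      omega
    have h1 := (cnt_eq_self_iff (S := S) (k := i.val + 1) i.isLt).2 hall
    have h2 := (galeLE_iff_cnt.1 h).2 (i.val + 1)
    have h3 := cnt_add_one_le_self (S := R) (k := i.val + 1) i.isLt hi (by omega)
    omega
  obtain ⟨x, ⟨hx, hxi⟩, hmin⟩ := exists_first hex
  refine ⟨x, hxi, hx, fun y hy => ?_⟩
  by_contra hyS
  exact hmin y hy ⟨hyS, hy.le.trans hxi⟩

end Counting

/-! ### Exchangeable blocks in a pair of columns without multiplicitous configurations. -/

section Pairs

variable {n : ℕ} {P Q C₁ C₂ C₁' C₂' : Finset (Fin n)} {s t : ℕ} {i : Fin n}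

/-- The rows `[s, t)` of the columns `C₁ ≤ P` and `C₂ ≤ Q` can be exchanged, without a change of
the rows above `i`. -/
structure Exchangeable (P Q C₁ C₂ : Finset (Fin n)) (s t : ℕ) (i : Fin n) : Prop where
  left_start : cnt C₁ s = cnt P s
  left_end : cnt C₁ t = cnt P t
  right_start : cnt C₂ s = cnt Q s
  right_end : cnt C₂ t = cnt Q t
  agree : ∀ k : Fin n, s ≤ k.val → k < i → (k ∈ C₁ ↔ k ∈ C₂)

theorem Exchangeable.symm (h : Exchangeable P Q C₁ C₂ s t i) : Exchangeable Q P C₂ C₁ s t i :=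
  ⟨h.3, h.4, h.1, h.2, fun k h1 h2 => (h.5 k h1 h2).symm⟩

/-- Two members of the Gale interval below `P` that first differ in row `i`. -/
structure Branch (P C C' : Finset (Fin n)) (i : Fin n) : Prop where
  le : GaleLE C P
  le' : GaleLE C' P
  agree : ∀ k < i, (k ∈ C ↔ k ∈ C')
  mem : i ∈ C
  notMem : i ∉ C'

/-- Both sets have the size of `P`, so the set that misses `i` must catch up in a later row. -/
theorem Branch.exists_mem_lt (h : Branch P C₁ C₁' i) : ∃ u ∈ C₁', i < u := by
  have h1 : cnt C₁ i.val = cnt C₁' i.val := cnt_congr fun k hk => h.agree k hk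
  have h2 := cnt_succ_of_mem h.mem
  have h3 := cnt_succ_of_notMem h.notMem
  have h4 := h.le.card_eq
  have h5 := h.le'.card_eq
  have h6 := cnt_le_card C₁ (i.val + 1)
  obtain ⟨u, hu, hu1, hu2⟩ := exists_mem_of_cnt_lt (S := C₁') (k := i.val + 1) (l := n) i.isLt
    (by rw [cnt_size]; omega)
  exact ⟨u, hu, hu1⟩

theorem GaleLE.exists_lt (h : GaleLE C₁ P) {u : Fin n} (hu : u ∈ C₁) : ∃ v ∈ P, u ≤ v := by
  obtain ⟨h1, h2⟩ := galeLE_iff_cnt.1 h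
  have h3 := cnt_add_one_le hu le_rfl u.isLt
  rw [cnt_size] at h3
  have h4 := h2 u.val
  obtain ⟨v, hv, hv1, -⟩ := exists_mem_of_cnt_lt (S := P) (k := u.val) (l := n) u.isLt.le
    (by rw [cnt_size]; omega)
  exact ⟨v, hv, hv1⟩

theorem Branch.exists_lt (h : Branch P C₁ C₁' i) : ∃ u ∈ P, i < u := by
  obtain ⟨u, hu, hiu⟩ := h.exists_mem_lt
  obtain ⟨v, hv, huv⟩ := h.le'.exists_lt hu
  exact ⟨v, hv, lt_of_lt_of_le hiu huv⟩

/-- Equal columns. The block starts at the second gap of `P` if that gap lies weakly before `i`, and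
at the top otherwise; it reaches to the bottom of the grid. -/
theorem exchange_of_eq (hPP : ¬ MultiplicitousPair P P) (h₁ : Branch P C₁ C₁' i)
    (h₂ : Branch P C₂' C₂ i) {m : Fin n} (hm : m ∉ P) (hmin : ∀ k < m, k ∈ P) (hmi : m ≤ i) :
    ∃ s t : ℕ, s ≤ i.val ∧ i.val < t ∧ Exchangeable P P C₁ C₂ s t i := by
  by_cases hz : ∃ z, m < z ∧ z ≤ i ∧ z ∉ P
  · obtain ⟨z, ⟨hmz, hzi, hzP⟩, hzmin⟩ := exists_first hz
    obtain ⟨u, hu, hiu⟩ := h₁.exists_lt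
    have hcz : cnt P z.val + 1 = z.val := by
      refine cnt_add_one_eq_self z.isLt.le hm hmz fun y hy hne => ?_
      rcases lt_or_gt_of_ne hne with hlt | hgt
      · exact hmin y hlt
      · by_contra hyP
        exact hzmin y hy ⟨hgt, (le_of_lt hy).trans hzi, hyP⟩
    -- Two elements of `P` after the gaps `m` and `z` would form configuration C in the pair `(P,
    -- P)`.
    have hcard : P.card ≤ cnt P z.val + 1 := by
      rw [← cnt_size, cnt_add P z.isLt.le]
      have : (P.filter fun i => z.val ≤ i.val ∧ i.val < n).card ≤ 1 := by
        refine Finset.card_le_one.2 fun a ha b hb => ?_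
        simp only [Finset.mem_filter] at ha hb
        have key : ∀ a b : Fin n, a ∈ P → b ∈ P → z.val ≤ a.val → a < b → False := by
          intro a b ha hb hza hab
          refine hPP (Or.inr (Or.inr (Or.inl ⟨m, z, a, b, hmz, ?_, hab, ⟨hm, hm⟩, ⟨hzP, hzP⟩,
            ⟨ha, ha⟩, hb⟩)))
          refine lt_of_le_of_ne hza fun h => hzP ?_
          rw [h]; exact ha
        rcases lt_trichotomy a b with h | h | h
        · exact (key a b ha.1 hb.1 ha.2.1 h).elim
        · exact h
        · exact (key b a hb.1 ha.1 hb.2.1 h).elim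
      omega
    obtain ⟨v, hv, hiv⟩ := h₂.exists_mem_lt
    have hzi' : z.val ≤ i.val := hzi
    have hiv' : i.val < v.val := hiv
    have hg1 := (galeLE_iff_cnt.1 h₁.le).2 z.val
    have hg2 := (galeLE_iff_cnt.1 h₂.le').2 z.val
    have hc1 := h₁.le.card_eq
    have hc2 := h₂.le'.card_eq
    have hu1 := cnt_add_one_le h₁.mem hzi' i.isLt
    have hu2 := cnt_add_one_le hv (hzi'.trans hiv'.le) v.isLt
    rw [cnt_size] at hu1 hu2
    -- At most one element of each column can lie from row `z` on: it is `i` in `C₁` and `v > i` in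
    -- `C₂`. Hence both are balanced at `z` and empty on `[z, i)`.
    refine ⟨z.val, n, hzi, i.isLt, ⟨by omega, by rw [cnt_size, cnt_size, hc1], by omega,
      by rw [cnt_size, cnt_size, hc2], fun k hk hki => ?_⟩⟩
    constructor
    · intro hkC
      have := eq_of_cnt_le_add_one (k := z.val) (l := n) (by rw [cnt_size]; omega) hkC h₁.mem hk
        k.isLt hzi' i.isLt
      exact absurd this hki.ne
    · intro hkC
      have := eq_of_cnt_le_add_one (k := z.val) (l := n) (by rw [cnt_size]; omega) hkC hv hk
        k.isLt (hzi'.trans hiv'.le) v.isLt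
      exact absurd this (hki.trans hiv).ne
  · push Not at hz
    -- Here `m` is the only gap of `P` up to row `i`. So `C₁'` and `C₂`, which miss `i`, contain
    -- every earlier row, and `C₁` agrees with `C₁'` there.
    refine ⟨0, n, Nat.zero_le _, i.isLt, ⟨by simp [cnt], ?_, by simp [cnt], ?_, ?_⟩⟩
    · rw [cnt_size, cnt_size, h₁.le.card_eq]
    · rw [cnt_size, cnt_size, h₂.le'.card_eq]
    · have hcz : cnt P (i.val + 1) + 1 = i.val + 1 := by
        refine cnt_add_one_eq_self i.isLt hm (Nat.lt_succ_of_le hmi) fun y hy hne => ?_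
        rcases lt_or_gt_of_ne hne with hlt | hgt
        · exact hmin y hlt
        · exact hz y hgt (Nat.le_of_lt_succ hy)
      have hg1 := (galeLE_iff_cnt.1 h₁.le').2 (i.val + 1)
      have hg2 := (galeLE_iff_cnt.1 h₂.le').2 (i.val + 1)
      intro k _ hki
      have hki' : k.val < i.val + 1 := Nat.lt_succ_of_lt hki
      have h1 : k ∈ C₁' := mem_of_le_cnt_add_one (k := i.val + 1) i.isLt h₁.notMem (Nat.lt_succ_self _)
        (by omega) hki' hki.ne
      have h2 : k ∈ C₂ := mem_of_le_cnt_add_one (k := i.val + 1) i.isLt h₂.notMem (Nat.lt_succ_self _)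
        (by omega) hki' hki.ne
      exact ⟨fun _ => h2, fun _ => (h₁.agree k hki).2 h1⟩

/-- Configurations A and C confine `Q` to the rows before `z`, the first row after `m` that is a gap
of `P` or the row `d`. Before `z` both columns are full except for `m`, and `[0, z)` is the block.
The pair `(C₁', C₂')` is used because `C₁'` misses `i` and hence is balanced at `z`, whereas `C₁`
may contain all rows before `z`. -/
theorem exchange_of_first_diff (hPQ : ¬ MultiplicitousPair P Q) (h₁ : Branch P C₁ C₁' i)
    (h₂ : Branch Q C₂' C₂ i) {m d : Fin n} (hmP : m ∉ P) (hmQ : m ∉ Q)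
    (hminP : ∀ k < m, k ∈ P) (hminQ : ∀ k < m, k ∈ Q)
    (hdP : d ∈ P) (hdQ : d ∉ Q) (hd : ∀ k < d, (k ∈ P ↔ k ∈ Q)) :
    ∃ s t : ℕ, s ≤ i.val ∧ i.val < t ∧ (∀ k : Fin n, s ≤ k.val → k.val < t → (k ∈ P ↔ k ∈ Q)) ∧
      Exchangeable P Q C₁' C₂' s t i := by
  have hmd : m < d := by
    rcases lt_trichotomy m d with h | h | h
    · exact h
    · exact absurd hdP (h ▸ hmP)
    · exact absurd (hminQ d h) hdQ
  have hQd : ∀ k ∈ Q, k < d := by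
    intro k hk
    rcases lt_trichotomy k d with h | h | h
    · exact h
    · exact absurd hk (h ▸ hdQ)
    · exact (hPQ (Or.inl ⟨m, d, k, hmd, h, ⟨hmP, hmQ⟩, ⟨hdP, hdQ⟩, hk⟩)).elim
  obtain ⟨z, ⟨hmz, hz⟩, hzmin⟩ := exists_first (p := fun z => m < z ∧ (z ∉ P ∨ z = d))
    ⟨d, hmd, Or.inr rfl⟩
  have hzd : z ≤ d := not_lt.1 fun h => hzmin d h ⟨hmd, Or.inr rfl⟩
  have hzQ : z ∉ Q := by
    rcases lt_or_eq_of_le hzd with h | h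
    · rcases hz with h1 | h1
      · exact fun h2 => h1 ((hd z h).2 h2)
      · exact absurd h1 h.ne
    · exact h ▸ hdQ
  have hQz : ∀ k ∈ Q, k < z := by
    intro k hk
    by_contra hkz
    have hzk : z < k := lt_of_le_of_ne (not_lt.1 hkz) fun h => hzQ (h ▸ hk)
    have hkd := hQd k hk
    have hzP : z ∉ P := by
      rcases hz with h1 | h1
      · exact h1
      · exact absurd (h1 ▸ hzk) (not_lt.2 hkd.le)
    exact hPQ (Or.inr (Or.inr (Or.inl ⟨m, z, k, d, hmz, hzk, hkd, ⟨hmP, hmQ⟩, ⟨hzP, hzQ⟩,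
      ⟨(hd k hkd).2 hk, hk⟩, hdP⟩)))
  obtain ⟨v, hv, hiv⟩ := h₂.exists_lt
  have hiz : i < z := hiv.trans (hQz v hv)
  have hPz : ∀ y : Fin n, y.val < z.val → y ≠ m → y ∈ P := by
    intro y hy hne
    rcases lt_or_gt_of_ne hne with hlt | hgt
    · exact hminP y hlt
    · by_contra hyP
      exact hzmin y hy ⟨hgt, Or.inl hyP⟩
  have hcP : cnt P z.val + 1 = z.val := cnt_add_one_eq_self z.isLt.le hmP hmz hPz
  have hcQ : cnt Q z.val + 1 = z.val := cnt_add_one_eq_self z.isLt.le hmQ hmz fun y hy hne =>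
    (hd y (lt_of_lt_of_le hy hzd)).1 (hPz y hy hne)
  have hcQ' : cnt Q z.val = Q.card := cnt_eq_card_of_forall_lt fun k hk => hQz k hk
  have hg1 := (galeLE_iff_cnt.1 h₁.le').2 z.val
  have hg2 := (galeLE_iff_cnt.1 h₂.le).2 z.val
  have hg2' := (galeLE_iff_cnt.1 h₂.le').2 z.val
  have hu1 := cnt_add_one_le_self z.isLt.le h₁.notMem hiz
  have hu2 := cnt_le_card C₂' z.val
  have hc2 := h₂.le.card_eq
  refine ⟨0, z.val, Nat.zero_le _, hiz, fun k _ hk => hd k (lt_of_lt_of_le hk hzd), by simp [cnt],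
    by omega, by simp [cnt], by omega, fun k _ hki => ?_⟩
  have h1 : k ∈ C₁' := mem_of_le_cnt_add_one z.isLt.le h₁.notMem hiz (by omega)
    (hki.trans hiz) hki.ne
  have h2 : k ∈ C₂ := mem_of_le_cnt_add_one z.isLt.le h₂.notMem hiz (by omega)
    (hki.trans hiz) hki.ne
  exact ⟨fun _ => (h₂.agree k hki).2 h2, fun _ => h1⟩

/-- Configurations D, E and F make `q` a common gap. After it, A and B leave `u` as the only element
of `P` and as the first element of `Q`. The block consists of the rows from `q` to `u`. -/
theorem exchange_of_gap_lt (hPQ : ¬ MultiplicitousPair P Q) (hQP : ¬ MultiplicitousPair Q P)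
    (h₁ : Branch P C₁ C₁' i) (h₂ : Branch Q C₂' C₂ i) {p q : Fin n} (hp : p ∉ P) (hq : q ∉ Q)
    (hminQ : ∀ k < q, k ∈ Q) (hpq : p < q) (hqi : q ≤ i) :
    ∃ s t : ℕ, s ≤ i.val ∧ i.val < t ∧ (∀ k : Fin n, s ≤ k.val → k.val < t → (k ∈ P ↔ k ∈ Q)) ∧
      Exchangeable P Q C₁ C₂ s t i := by
  obtain ⟨u, hu, hiu⟩ := h₁.exists_lt
  obtain ⟨v, hv, hiv⟩ := h₂.exists_lt
  have hpQ := hminQ p hpq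
  have hqu := lt_of_le_of_lt hqi hiu
  have hqv := lt_of_le_of_lt hqi hiv
  have hqP : q ∉ P := by
    intro hqP
    have hvP : v ∉ P := fun h => hPQ (Or.inr (Or.inr (Or.inr (Or.inl
      ⟨p, q, v, hpq, hqv, ⟨hp, hpQ⟩, ⟨hqP, hq⟩, h, hv⟩))))
    have huQ : u ∉ Q := fun h => hPQ (Or.inr (Or.inr (Or.inr (Or.inl
      ⟨p, q, u, hpq, hqu, ⟨hp, hpQ⟩, ⟨hqP, hq⟩, hu, h⟩))))
    rcases lt_trichotomy u v with h | h | h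
    · exact hPQ (Or.inr (Or.inr (Or.inr (Or.inr (Or.inl
        ⟨p, q, u, v, hpq, hqu, h, ⟨hp, hpQ⟩, ⟨hqP, hq⟩, ⟨hu, huQ⟩, hvP, hv⟩)))))
    · exact huQ (h ▸ hv)
    · exact hQP (Or.inr (Or.inr (Or.inr (Or.inr (Or.inr
        ⟨p, q, v, u, hpq, hqv, h, ⟨hpQ, hp⟩, ⟨hq, hqP⟩, ⟨hv, hvP⟩, huQ, hu⟩)))))
  have hA : ∀ x y : Fin n, q < x → x < y → x ∈ P → x ∉ Q → y ∈ Q → False :=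
    fun x y h1 h2 h3 h4 h5 => hPQ (Or.inl ⟨q, x, y, h1, h2, ⟨hqP, hq⟩, ⟨h3, h4⟩, h5⟩)
  have hA' : ∀ x y : Fin n, q < x → x < y → x ∉ P → x ∈ Q → y ∈ P → False :=
    fun x y h1 h2 h3 h4 h5 => hQP (Or.inl ⟨q, x, y, h1, h2, ⟨hq, hqP⟩, ⟨h4, h3⟩, h5⟩)
  have hB : ∀ x y : Fin n, q < x → x < y → x ∈ P → x ∈ Q → y ∈ P → False :=
    fun x y h1 h2 h3 h4 h5 => hPQ (Or.inr (Or.inl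
      ⟨p, q, x, y, hpq, h1, h2, ⟨hp, hpQ⟩, ⟨hqP, hq⟩, ⟨h3, h4⟩, h5⟩))
  have huQ : u ∈ Q := by
    by_contra huQ
    rcases lt_trichotomy u v with h | h | h
    · exact hA u v hqu h hu huQ hv
    · exact huQ (h ▸ hv)
    · by_cases hvP : v ∈ P
      · exact hB v u hqv h hvP hv hu
      · exact hA' v u hqv h hvP hv hu
  have hPu : ∀ x ∈ P, q.val ≤ x.val → x = u := by
    intro x hx hqx
    have hqx : q < x := lt_of_le_of_ne hqx fun h => hqP (h ▸ hx)
    rcases lt_trichotomy x u with h | h | h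
    · by_cases hxQ : x ∈ Q
      · exact (hB x u hqx h hx hxQ hu).elim
      · exact (hA x u hqx h hx hxQ huQ).elim
    · exact h
    · exact (hB u x hqu h hu huQ hx).elim
  have hQu : ∀ x ∈ Q, q.val ≤ x.val → x.val < u.val + 1 → x = u := by
    intro x hx hqx hxu
    have hqx : q < x := lt_of_le_of_ne hqx fun h => hq (h ▸ hx)
    rcases lt_or_eq_of_le (Nat.le_of_lt_succ hxu) with h | h
    · have hxP : x ∉ P := fun hxP => by
        have := hPu x hxP hqx.le
        rw [this] at h
        exact lt_irrefl _ h
      exact (hA' x u hqx h hxP hx hu).elim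
    · exact Fin.ext h
  have hqi' : q.val ≤ i.val := hqi
  have hiu' : i.val < u.val := hiu
  have hqu' : q.val < u.val := hqu
  have hPq : cnt P u.val = cnt P q.val :=
    cnt_eq_of_forall hqu'.le fun x hx h1 h2 => by rw [hPu x hx h1] at h2; omega
  have hPu1 := cnt_succ_of_mem hu
  have hPc : cnt P (u.val + 1) = P.card := cnt_eq_card_of_forall_lt fun x hx => by
    by_cases h : q.val ≤ x.val
    · rw [hPu x hx h]; omega
    · omega
  have hQq : cnt Q u.val = cnt Q q.val :=
    cnt_eq_of_forall hqu'.le fun x hx h1 h2 => by rw [hQu x hx h1 (by omega)] at h2; omega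
  have hQu1 := cnt_succ_of_mem huQ
  have hQq' : cnt Q q.val = q.val := (cnt_eq_self_iff q.isLt.le).2 fun k hk => hminQ k hk
  obtain ⟨hc1, hg1⟩ := galeLE_iff_cnt.1 h₁.le
  obtain ⟨hc2, hg2⟩ := galeLE_iff_cnt.1 h₂.le'
  have hi1 := cnt_add_one_le h₁.mem hqi' i.isLt
  rw [cnt_size] at hi1
  have e1 : cnt C₁ q.val = cnt P q.val := by have := hg1 q.val; omega
  have e2 : cnt C₁ (u.val + 1) = cnt P (u.val + 1) := by
    have := hg1 (u.val + 1); have := cnt_le_card C₁ (u.val + 1); omega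
  have e3 : cnt C₂ q.val = cnt Q q.val := by
    have := hg2 q.val
    -- `Q` is full before row `q`, so its count there is already the largest possible.
    have h3 := cnt_compl C₂ (k := q.val) q.isLt.le
    omega
  obtain ⟨w, hw, hiw⟩ := h₂.exists_mem_lt
  have hiw' : i.val < w.val := hiw
  -- If `u` directly follows `q`, then `i = q` and no row of the block precedes `i`. Otherwise row
  -- `q + 1` is a second common gap, and configuration C for `(Q, P)` prevents `Q` from continuing
  -- after `u`.
  by_cases hadj : u.val = q.val + 1
  · have e4 : cnt C₂ (u.val + 1) = cnt Q (u.val + 1) := by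
      have h3 := hg2 (u.val + 1)
      have h4 := cnt_add_one_le_self (k := u.val + 1) u.isLt h₂.notMem (by omega)
      omega
    exact ⟨q.val, u.val + 1, hqi, by omega, fun k hk hk' =>
      ⟨fun h => by rw [hPu k h hk]; exact huQ, fun h => by rw [hQu k h hk hk']; exact hu⟩,
      e1, e2, e3, e4, fun k hk hki => by have : k.val < i.val := hki; omega⟩
  · have hQc : cnt Q (u.val + 1) = Q.card := cnt_eq_card_of_forall_lt fun x hx => by
      by_contra hxu
      have hz : q.val + 1 < n := by have := u.isLt; omega
      have hzP : (⟨q.val + 1, hz⟩ : Fin n) ∉ P := fun h => hadj (by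
        have := hPu _ h (by simp); rw [← this])
      have hzQ : (⟨q.val + 1, hz⟩ : Fin n) ∉ Q := fun h => hadj (by
        have := hQu _ h (by simp) (by simp; omega); rw [← this])
      refine hQP (Or.inr (Or.inr (Or.inl ⟨q, ⟨q.val + 1, hz⟩, u, x, ?_, ?_, ?_, ⟨hq, hqP⟩,
        ⟨hzQ, hzP⟩, ⟨huQ, hu⟩, hx⟩)))
      · exact Nat.lt_succ_self q.val
      · change q.val + 1 < u.val; omega
      · change u.val < x.val; omega
    have e4 : cnt C₂ (u.val + 1) = cnt Q (u.val + 1) := by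
      have h3 := hg2 (u.val + 1)
      have h4 := cnt_le_card C₂ (u.val + 1)
      omega
    refine ⟨q.val, u.val + 1, hqi, by omega, fun k hk hk' =>
      ⟨fun h => by rw [hPu k h hk]; exact huQ, fun h => by rw [hQu k h hk hk']; exact hu⟩,
      e1, e2, e3, e4, fun k hk hki => ?_⟩
    constructor
    · intro hkC
      have := eq_of_cnt_le_add_one (k := q.val) (l := n) (by rw [cnt_size]; omega) hkC h₁.mem hk
        k.isLt hqi' i.isLt
      exact absurd this hki.ne
    · intro hkC
      have := eq_of_cnt_le_add_one (k := q.val) (l := n) (by rw [cnt_size]; omega) hkC hw hk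
        k.isLt (hqi'.trans hiw'.le) w.isLt
      exact absurd this (hki.trans hiw).ne

/-- If two columns `P`, `Q` contain no multiplicitous configuration, and two pairs `(C₁, C₂)` and
`(C₁', C₂')` below `(P, Q)` first differ in row `i` and in opposite ways, then one of the two pairs
admits an exchange of rows which changes row `i`, but no row above. -/
theorem exists_exchangeable (hPQ : ¬ MultiplicitousPair P Q) (hQP : ¬ MultiplicitousPair Q P)
    (h₁ : Branch P C₁ C₁' i) (h₂ : Branch Q C₂' C₂ i) :
    ∃ s t : ℕ, s ≤ i.val ∧ i.val < t ∧ (∀ k : Fin n, s ≤ k.val → k.val < t → (k ∈ P ↔ k ∈ Q)) ∧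
      (Exchangeable P Q C₁ C₂ s t i ∨ Exchangeable P Q C₁' C₂' s t i) := by
  -- The cases are governed by the first gaps of `P` and `Q`; both lie weakly before `i`, since
  -- `C₁'` and `C₂` miss `i`.
  obtain ⟨p, hpi, hp, hpmin⟩ := h₁.le'.exists_gap h₁.notMem
  obtain ⟨q, hqi, hq, hqmin⟩ := h₂.le'.exists_gap h₂.notMem
  rcases lt_trichotomy p q with hlt | heq | hgt
  · obtain ⟨s, t, h1, h2, h3, h4⟩ := exchange_of_gap_lt hPQ hQP h₁ h₂ hp hq hqmin hlt hqi
    exact ⟨s, t, h1, h2, h3, Or.inl h4⟩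
  · subst heq
    by_cases hd : ∃ d, ¬ (d ∈ P ↔ d ∈ Q)
    · obtain ⟨d, hd, hdmin⟩ := exists_first hd
      simp only [not_not] at hdmin
      by_cases hdP : d ∈ P
      · obtain ⟨s, t, h1, h2, h3, h4⟩ := exchange_of_first_diff hPQ h₁ h₂ hp hq hpmin hqmin
          hdP (fun h => hd ⟨fun _ => h, fun _ => hdP⟩) hdmin
        exact ⟨s, t, h1, h2, h3, Or.inr h4⟩
      · have hdQ : d ∈ Q := by
          by_contra h
          exact hd ⟨fun h' => absurd h' hdP, fun h' => absurd h' h⟩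
        obtain ⟨s, t, h1, h2, h3, h4⟩ := exchange_of_first_diff hQP h₂ h₁ hq hp hqmin hpmin
          hdQ hdP (fun k hk => (hdmin k hk).symm)
        exact ⟨s, t, h1, h2, fun k hk hk' => (h3 k hk hk').symm, Or.inl h4.symm⟩
    · push Not at hd
      have : P = Q := Finset.ext hd
      subst this
      obtain ⟨s, t, h1, h2, h3⟩ := exchange_of_eq hPQ h₁ h₂ hp hpmin hpi
      exact ⟨s, t, h1, h2, fun _ _ _ => Iff.rfl, Or.inl h3⟩
  · obtain ⟨s, t, h1, h2, h3, h4⟩ := exchange_of_gap_lt hQP hPQ h₂ h₁ hq hp hpmin hgt hpi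
    exact ⟨s, t, h1, h2, fun k hk hk' => (h3 k hk hk').symm, Or.inr h4.symm⟩

end Pairs

/-! ### Flagged fillings, row by row. -/

section Fillings

variable {n : ℕ} {D C E : Diagram n}

/-- The entry in row `i` and column `a`, extended by `i` to the rows without a box. -/
def FlaggedFilling.ent (F : FlaggedFilling D) (a i : Fin n) : Fin n :=
  if h : i ∈ D a then F.entry a ⟨i, h⟩ else i

theorem FlaggedFilling.ent_of_mem (F : FlaggedFilling D) {a i : Fin n} (h : i ∈ D a) :
    F.ent a i = F.entry a ⟨i, h⟩ := dif_pos h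

theorem FlaggedFilling.ent_of_notMem (F : FlaggedFilling D) {a i : Fin n} (h : i ∉ D a) :
    F.ent a i = i := dif_neg h

theorem FlaggedFilling.ent_le (F : FlaggedFilling D) (a i : Fin n) : F.ent a i ≤ i := by
  by_cases h : i ∈ D a
  · rw [F.ent_of_mem h]; exact F.flagged a ⟨i, h⟩
  · rw [F.ent_of_notMem h]

theorem FlaggedFilling.ent_injOn (F : FlaggedFilling D) {a i k : Fin n} (hi : i ∈ D a)
    (hk : k ∈ D a) (h : F.ent a i = F.ent a k) : i = k := by
  rw [F.ent_of_mem hi, F.ent_of_mem hk] at h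
  exact congrArg Subtype.val (F.injective a h)

theorem FlaggedFilling.ext_ent {F G : FlaggedFilling D} (h : ∀ a i, F.ent a i = G.ent a i) :
    F = G := by
  apply FlaggedFilling.ext
  funext a i
  have := h a i.1
  rwa [F.ent_of_mem i.2, G.ent_of_mem i.2] at this

theorem mem_fillings_iff {F : FlaggedFilling D} :
    F ∈ fillings D C ↔ ∀ a x, x ∈ C a ↔ ∃ i ∈ D a, F.ent a i = x := by
  have key : ∀ a x, x ∈ Set.range (F.entry a) ↔ ∃ i ∈ D a, F.ent a i = x := by
    intro a x
    constructor
    · rintro ⟨i, rfl⟩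
      exact ⟨i.1, i.2, F.ent_of_mem i.2⟩
    · rintro ⟨i, hi, rfl⟩
      exact ⟨⟨i, hi⟩, (F.ent_of_mem hi).symm⟩
  constructor
  · intro h a x
    rw [← key, h a, Finset.mem_coe]
  · intro h a
    ext x
    rw [key, ← h a x, Finset.mem_coe]

/-- Grouping by rows makes the weight visibly invariant under permutations of the columns within a
row. The inversions are grouped by pairs of rows in `inv_eq` for the same reason. -/
theorem FlaggedFilling.weight_eq (F : FlaggedFilling D) :
    F.weight = ∏ i, ∏ a, if i ∈ D a then matrixY n (F.ent a i) i else 1 := by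
  rw [Finset.prod_comm]
  refine Finset.prod_congr rfl fun a _ => ?_
  rw [← Finset.prod_filter, Finset.filter_mem_eq_inter, Finset.univ_inter,
    ← Finset.prod_coe_sort (D a) fun i => matrixY n (F.ent a i) i]
  refine Finset.prod_congr rfl fun i _ => ?_
  rw [F.ent_of_mem i.2]
  simp only [matrixY, Matrix.of_apply]
  rw [dif_pos (F.flagged a i)]

theorem FlaggedFilling.invColumn_eq (F : FlaggedFilling D) (a : Fin n) :
    F.invColumn a = ∑ p : Fin n × Fin n,
      if p.1 ∈ D a ∧ p.2 ∈ D a ∧ p.1 < p.2 ∧ F.ent a p.2 < F.ent a p.1 then 1 else 0 := by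
  rw [← Finset.card_filter, FlaggedFilling.invColumn, ← Nat.card_eq_finsetCard]
  refine Nat.card_congr ⟨fun p => ⟨(p.1.1.1, p.1.2.1), ?_⟩, fun p =>
    ⟨(⟨p.1.1, (Finset.mem_filter.1 p.2).2.1⟩, ⟨p.1.2, (Finset.mem_filter.1 p.2).2.2.1⟩), ?_⟩,
    fun p => rfl, fun p => rfl⟩
  · obtain ⟨⟨⟨i, hi⟩, ⟨k, hk⟩⟩, h1, h2⟩ := p
    refine Finset.mem_filter.2 ⟨Finset.mem_univ _, hi, hk, h1, ?_⟩
    rw [F.ent_of_mem hi, F.ent_of_mem hk]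
    exact h2
  · obtain ⟨⟨i, k⟩, hp⟩ := p
    obtain ⟨-, hi, hk, h1, h2⟩ := Finset.mem_filter.1 hp
    refine ⟨h1, ?_⟩
    rw [F.ent_of_mem hi, F.ent_of_mem hk] at h2
    exact h2

theorem FlaggedFilling.inv_eq (F : FlaggedFilling D) :
    F.inv = ∑ p : Fin n × Fin n, ∑ a,
      if p.1 ∈ D a ∧ p.2 ∈ D a ∧ p.1 < p.2 ∧ F.ent a p.2 < F.ent a p.1 then 1 else 0 := by
  rw [Finset.sum_comm]
  exact Finset.sum_congr rfl fun a _ => F.invColumn_eq a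

/-- In a filling of a column that is balanced at `k`, the boxes above row `k` hold exactly the
entries that are smaller than `k`. -/
theorem ent_lt_iff {F : FlaggedFilling D} (hF : F ∈ fillings D C) {a : Fin n} {k : ℕ}
    (hk : cnt (C a) k = cnt (D a) k) {i : Fin n} (hi : i ∈ D a) :
    (F.ent a i).val < k ↔ i.val < k := by
  rw [mem_fillings_iff] at hF
  constructor
  · intro hlt
    -- Flaggedness gives an injection from the boxes before row `k` to the entries smaller than `k`;
    -- balance makes it surjective, so no later box can hold such an entry.
    have himg : ((D a).filter fun i => i.val < k).image (F.ent a) =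
        (C a).filter fun i => i.val < k := by
      apply Finset.eq_of_subset_of_card_le
      · intro x hx
        obtain ⟨y, hy, rfl⟩ := Finset.mem_image.1 hx
        obtain ⟨hy, hyk⟩ := Finset.mem_filter.1 hy
        exact Finset.mem_filter.2 ⟨(hF a _).2 ⟨y, hy, rfl⟩, lt_of_le_of_lt (F.ent_le a y) hyk⟩
      · rw [Finset.card_image_of_injOn]
        · exact hk.le
        · intro x hx y hy hxy
          exact F.ent_injOn (Finset.mem_filter.1 hx).1 (Finset.mem_filter.1 hy).1 hxy
    have hmem : F.ent a i ∈ (C a).filter fun i => i.val < k :=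
      Finset.mem_filter.2 ⟨(hF a _).2 ⟨i, hi, rfl⟩, hlt⟩
    rw [← himg] at hmem
    obtain ⟨y, hy, hyi⟩ := Finset.mem_image.1 hmem
    obtain ⟨hy, hyk⟩ := Finset.mem_filter.1 hy
    rwa [← F.ent_injOn hy hi hyi]
  · exact fun h => lt_of_le_of_lt (F.ent_le a i) h

/-! ### Exchanging a block of rows. -/

/-- `E` arises from `C` by exchanging the rows `[s, t)` of the columns according to `π`; the
exchanged parts of the columns of `D` are equal, and the columns that are moved are balanced at
`s` and `t`. -/
structure IsExchange (D C E : Diagram n) (π : Equiv.Perm (Fin n)) (s t : ℕ) : Prop where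
  involutive : ∀ a, π (π a) = a
  base : ∀ a (i : Fin n), s ≤ i.val → i.val < t → (i ∈ D (π a) ↔ i ∈ D a)
  mem_iff : ∀ a (i : Fin n), i ∈ E a ↔ if s ≤ i.val ∧ i.val < t then i ∈ C (π a) else i ∈ C a
  le : s ≤ t
  start : ∀ a, π a ≠ a → cnt (C a) s = cnt (D a) s
  finish : ∀ a, π a ≠ a → cnt (C a) t = cnt (D a) t

namespace IsExchange

variable {π : Equiv.Perm (Fin n)} {s t : ℕ}

theorem cnt_of_le (h : IsExchange D C E π s t) (a : Fin n) {k : ℕ} (hk : k ≤ s) :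
    cnt (E a) k = cnt (C a) k :=
  cnt_congr fun i hi => by rw [h.mem_iff, if_neg (by omega)]

theorem cnt_inside (h : IsExchange D C E π s t) (a : Fin n) {k : ℕ} (hk : s ≤ k) (hkt : k ≤ t) :
    cnt (E a) k + cnt (C (π a)) s = cnt (C a) s + cnt (C (π a)) k := by
  have h1 := cnt_add (E a) hk
  have h2 := cnt_add (C (π a)) hk
  have h3 : (E a).filter (fun i => s ≤ i.val ∧ i.val < k) =
      (C (π a)).filter (fun i => s ≤ i.val ∧ i.val < k) := by
    ext i
    simp only [Finset.mem_filter]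
    refine and_congr_left fun hi => ?_
    rw [h.mem_iff, if_pos (by omega)]
  rw [h3, h.cnt_of_le a le_rfl] at h1
  omega

theorem cnt_base (h : IsExchange D C E π s t) (a : Fin n) {k : ℕ} (hk : s ≤ k) (hkt : k ≤ t) :
    cnt (D a) k + cnt (D (π a)) s = cnt (D a) s + cnt (D (π a)) k := by
  have h1 := cnt_add (D a) hk
  have h2 := cnt_add (D (π a)) hk
  have h3 : (D a).filter (fun i => s ≤ i.val ∧ i.val < k) =
      (D (π a)).filter (fun i => s ≤ i.val ∧ i.val < k) := by
    ext i
    simp only [Finset.mem_filter]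
    refine and_congr_left fun hi => ?_
    rw [h.base a i hi.1 (by omega)]
  rw [h3] at h1
  omega

theorem ne_symm (h : IsExchange D C E π s t) {a : Fin n} (ha : π a ≠ a) : π (π a) ≠ π a := by
  rw [h.involutive]; exact ha.symm

theorem eq_of_fixed (h : IsExchange D C E π s t) {a : Fin n} (ha : π a = a) : E a = C a := by
  ext i
  rw [h.mem_iff, ha, ite_self]

/-- Balance at both ends and equality of the blocks of `D` give the blocks of `C a` and `C (π a)`
the same size. -/
theorem cnt_end (h : IsExchange D C E π s t) (a : Fin n) : cnt (E a) t = cnt (C a) t := by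
  by_cases ha : π a = a
  · rw [h.eq_of_fixed ha]
  · have h1 := h.cnt_inside a h.le le_rfl
    have h2 := h.cnt_base a h.le le_rfl
    have h3 := h.start a ha
    have h4 := h.finish a ha
    have h5 := h.start _ (h.ne_symm ha)
    have h6 := h.finish _ (h.ne_symm ha)
    omega

theorem cnt_of_ge (h : IsExchange D C E π s t) (a : Fin n) {k : ℕ} (hk : t ≤ k) :
    cnt (E a) k = cnt (C a) k := by
  rw [cnt_add (E a) hk, cnt_add (C a) hk, h.cnt_end]
  congr 2
  ext i
  simp only [Finset.mem_filter]
  refine and_congr_left fun hi => ?_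
  rw [h.mem_iff, if_neg (by omega)]

theorem symm (h : IsExchange D C E π s t) : IsExchange D E C π s t where
  involutive := h.involutive
  base := h.base
  mem_iff a i := by
    rw [h.mem_iff, h.mem_iff, h.involutive]
    split_ifs <;> rfl
  le := h.le
  start a ha := by rw [h.cnt_of_le a le_rfl, h.start a ha]
  finish a ha := by rw [h.cnt_end, h.finish a ha]

theorem diagramLE (h : IsExchange D C E π s t) (hC : DiagramLE C D) : DiagramLE E D := by
  intro a
  obtain ⟨h1, h2⟩ := galeLE_iff_cnt.1 (hC a)
  rw [galeLE_iff_cnt]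
  have key : ∀ k, cnt (D a) k ≤ cnt (E a) k := by
    intro k
    by_cases hks : k ≤ s
    · rw [h.cnt_of_le a hks]; exact h2 k
    by_cases hkt : t ≤ k
    · rw [h.cnt_of_ge a hkt]; exact h2 k
    by_cases ha : π a = a
    · rw [h.eq_of_fixed ha]; exact h2 k
    -- Inside the block, the surplus of `E a` over `D a` equals that of `C (π a)` over `D (π a)`,
    -- because both start from zero at `s`.
    · have h3 := h.cnt_inside a (k := k) (by omega) (by omega)
      have h4 := h.cnt_base a (k := k) (by omega) (by omega)
      have h5 := h.start a ha
      have h6 := h.start _ (h.ne_symm ha)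
      have h7 := (galeLE_iff_cnt.1 (hC (π a))).2 k
      omega
  refine ⟨?_, key⟩
  by_cases htn : t ≤ n
  · rw [← h1, ← cnt_size, h.cnt_of_ge a htn, cnt_size]
  · have e1 : ∀ S : Finset (Fin n), cnt S t = S.card := fun S =>
      cnt_eq_card_of_forall_lt fun i _ => by omega
    rw [← h1, ← e1, h.cnt_end, e1]

theorem card_row (h : IsExchange D C E π s t) (i : Fin n) :
    (Finset.univ.filter fun a => i ∈ E a).card = (Finset.univ.filter fun a => i ∈ C a).card := by
  simp only [h.mem_iff]
  by_cases hi : s ≤ i.val ∧ i.val < t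
  · simp only [if_pos hi, Finset.card_filter]
    exact Equiv.sum_comp π fun a => if i ∈ C a then 1 else 0
  · simp only [if_neg hi]

/-- The exchange of rows of a filling. -/
def mapFilling (h : IsExchange D C E π s t) (F : fillings D C) : FlaggedFilling D where
  entry a i := if s ≤ i.1.val ∧ i.1.val < t then F.1.ent (π a) i else F.1.ent a i
  injective a := by
    rintro ⟨i, hi⟩ ⟨k, hk⟩ hik
    by_cases ha : π a = a
    · simp only [ha, ite_self] at hik
      exact Subtype.ext (F.1.ent_injOn hi hk hik)
    -- Entries of boxes in the block lie in `[s, t)` and all others lie outside, before and after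
    -- the exchange, so the mixed cases cannot collide.
    have s1 := fun j hj => ent_lt_iff F.2 (h.start a ha) (i := j) hj
    have t1 := fun j hj => ent_lt_iff F.2 (h.finish a ha) (i := j) hj
    have s2 := fun j hj => ent_lt_iff F.2 (h.start _ (h.ne_symm ha)) (i := j) hj
    have t2 := fun j hj => ent_lt_iff F.2 (h.finish _ (h.ne_symm ha)) (i := j) hj
    have si := s1 i hi
    have ti := t1 i hi
    have sk := s1 k hk
    have tk := t1 k hk
    have hval := congrArg Fin.val hik
    simp only at hik hval
    split_ifs at hik hval with h1 h2 h2
    · exact Subtype.ext (F.1.ent_injOn ((h.base a i h1.1 h1.2).2 hi)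
        ((h.base a k h2.1 h2.2).2 hk) hik)
    · have := s2 i ((h.base a i h1.1 h1.2).2 hi)
      have := t2 i ((h.base a i h1.1 h1.2).2 hi)
      omega
    · have := s2 k ((h.base a k h2.1 h2.2).2 hk)
      have := t2 k ((h.base a k h2.1 h2.2).2 hk)
      omega
    · exact Subtype.ext (F.1.ent_injOn hi hk hik)
  flagged a i := by
    split_ifs
    · exact F.1.ent_le _ _
    · exact F.1.ent_le _ _

theorem ent_mapFilling (h : IsExchange D C E π s t) (F : fillings D C) (a i : Fin n) :
    (h.mapFilling F).ent a i =
      if s ≤ i.val ∧ i.val < t then F.1.ent (π a) i else F.1.ent a i := by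
  by_cases hi : i ∈ D a
  · rw [FlaggedFilling.ent_of_mem _ hi]; rfl
  · rw [FlaggedFilling.ent_of_notMem _ hi]
    split_ifs with h1
    · rw [FlaggedFilling.ent_of_notMem]
      rwa [h.base a i h1.1 h1.2]
    · rw [FlaggedFilling.ent_of_notMem _ hi]

theorem mapFilling_mem (h : IsExchange D C E π s t) (F : fillings D C) :
    h.mapFilling F ∈ fillings D E := by
  rw [mem_fillings_iff]
  intro a x
  have hF := mem_fillings_iff.1 F.2
  simp only [h.ent_mapFilling, h.mem_iff]
  by_cases ha : π a = a
  · simp only [ha, ite_self, hF]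
  have s1 := fun j hj => ent_lt_iff F.2 (h.start a ha) (i := j) hj
  have t1 := fun j hj => ent_lt_iff F.2 (h.finish a ha) (i := j) hj
  have s2 := fun j hj => ent_lt_iff F.2 (h.start _ (h.ne_symm ha)) (i := j) hj
  have t2 := fun j hj => ent_lt_iff F.2 (h.finish _ (h.ne_symm ha)) (i := j) hj
  constructor
  · split_ifs with hx
    · rw [hF]
      rintro ⟨i, hi, rfl⟩
      have h1 := s2 i hi
      have h2 := t2 i hi
      have hi' : s ≤ i.val ∧ i.val < t := by omega
      exact ⟨i, (h.base a i hi'.1 hi'.2).1 hi, by rw [if_pos hi']⟩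
    · rw [hF]
      rintro ⟨i, hi, rfl⟩
      have h1 := s1 i hi
      have h2 := t1 i hi
      have hi' : ¬ (s ≤ i.val ∧ i.val < t) := by omega
      exact ⟨i, hi, by rw [if_neg hi']⟩
  · rintro ⟨i, hi, rfl⟩
    split_ifs with h1 h2 h2
    · exact (hF _ _).2 ⟨i, (h.base a i h1.1 h1.2).2 hi, rfl⟩
    · have := s2 i ((h.base a i h1.1 h1.2).2 hi)
      have := t2 i ((h.base a i h1.1 h1.2).2 hi)
      omega
    · have := s1 i hi
      have := t1 i hi
      omega
    · exact (hF _ _).2 ⟨i, hi, rfl⟩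

theorem weight_mapFilling (h : IsExchange D C E π s t) (F : fillings D C) :
    (h.mapFilling F).weight = F.1.weight := by
  rw [FlaggedFilling.weight_eq, FlaggedFilling.weight_eq]
  refine Finset.prod_congr rfl fun i _ => ?_
  simp only [h.ent_mapFilling]
  by_cases hi : s ≤ i.val ∧ i.val < t
  · simp only [if_pos hi]
    conv_rhs => rw [← Equiv.prod_comp π]
    refine Finset.prod_congr rfl fun a _ => ?_
    simp only [h.base a i hi.1 hi.2]
  · simp only [if_neg hi]

/-- Boxes on different sides of the boundary of the exchanged rows do not form an inversion. -/
theorem not_inversion (h : IsExchange D C E π s t) {F : FlaggedFilling D} (hF : F ∈ fillings D C)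
    {a : Fin n} (ha : π a ≠ a) {i k : Fin n}
    (hik : ¬ ((s ≤ i.val ∧ i.val < t) ↔ (s ≤ k.val ∧ k.val < t))) :
    ¬ (i ∈ D a ∧ k ∈ D a ∧ i < k ∧ F.ent a k < F.ent a i) := by
  rintro ⟨hi, hk, h1, h2⟩
  have := ent_lt_iff hF (h.start a ha) hi
  have := ent_lt_iff hF (h.start a ha) hk
  have := ent_lt_iff hF (h.finish a ha) hi
  have := ent_lt_iff hF (h.finish a ha) hk
  have h1' : i.val < k.val := h1
  have h2' : (F.ent a k).val < (F.ent a i).val := h2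
  have := h.le
  omega

theorem inv_mapFilling (h : IsExchange D C E π s t) (F : fillings D C) :
    (h.mapFilling F).inv = F.1.inv := by
  rw [FlaggedFilling.inv_eq, FlaggedFilling.inv_eq]
  refine Finset.sum_congr rfl fun p _ => ?_
  -- Two rows on the same side of the cuts are moved together, so their inversions are only permuted
  -- among columns. Two rows on different sides contribute nothing in moved columns.
  by_cases hp : (s ≤ p.1.val ∧ p.1.val < t) ↔ (s ≤ p.2.val ∧ p.2.val < t)
  · simp only [h.ent_mapFilling]
    by_cases hi : s ≤ p.1.val ∧ p.1.val < t
    · simp only [if_pos hi, if_pos (hp.1 hi)]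
      conv_rhs => rw [← Equiv.sum_comp π]
      refine Finset.sum_congr rfl fun a _ => ?_
      simp only [h.base a _ hi.1 hi.2, h.base a _ (hp.1 hi).1 (hp.1 hi).2]
    · simp only [if_neg hi, if_neg (fun h' => hi (hp.2 h'))]
  · refine Finset.sum_congr rfl fun a _ => ?_
    by_cases ha : π a = a
    · simp only [h.ent_mapFilling, ha, ite_self]
    · rw [if_neg (h.symm.not_inversion (h.mapFilling_mem F) ha hp),
        if_neg (h.not_inversion F.2 ha hp)]

/-- The exchange of rows as a bijection between sets of fillings. -/
def fillingsEquiv (h : IsExchange D C E π s t) : fillings D C ≃ fillings D E where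
  toFun F := ⟨h.mapFilling F, h.mapFilling_mem F⟩
  invFun F := ⟨h.symm.mapFilling F, h.symm.mapFilling_mem F⟩
  left_inv F := by
    apply Subtype.ext
    apply FlaggedFilling.ext_ent
    intro a i
    simp only [ent_mapFilling, h.involutive]
    split_ifs <;> rfl
  right_inv F := by
    apply Subtype.ext
    apply FlaggedFilling.ext_ent
    intro a i
    simp only [ent_mapFilling, h.involutive]
    split_ifs <;> rfl

end IsExchange

/-- There is a bijection between `F_D(C)` and `F_D(C')` which preserves signs and weights. -/
def FillingsMatch (D C C' : Diagram n) : Prop :=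
  ∃ φ : fillings D C ≃ fillings D C',
    ∀ F : fillings D C, (φ F).1.sgn = F.1.sgn ∧ (φ F).1.weight = F.1.weight

theorem FillingsMatch.refl (D C : Diagram n) : FillingsMatch D C C :=
  ⟨Equiv.refl _, fun _ => ⟨rfl, rfl⟩⟩

theorem FillingsMatch.symm (h : FillingsMatch D C E) : FillingsMatch D E C := by
  obtain ⟨φ, hφ⟩ := h
  refine ⟨φ.symm, fun F => ?_⟩
  have := hφ (φ.symm F)
  rw [Equiv.apply_symm_apply] at this
  exact ⟨this.1.symm, this.2.symm⟩

theorem FillingsMatch.trans {C' : Diagram n} (h : FillingsMatch D C E)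
    (h' : FillingsMatch D E C') : FillingsMatch D C C' := by
  obtain ⟨φ, hφ⟩ := h
  obtain ⟨ψ, hψ⟩ := h'
  exact ⟨φ.trans ψ, fun F => ⟨(hψ (φ F)).1.trans (hφ F).1, (hψ (φ F)).2.trans (hφ F).2⟩⟩

theorem IsExchange.fillingsMatch {π : Equiv.Perm (Fin n)} {s t : ℕ}
    (h : IsExchange D C E π s t) : FillingsMatch D C E :=
  ⟨h.fillingsEquiv, fun F =>
    ⟨congrArg (fun k => (-1 : ℤ) ^ k) (h.inv_mapFilling F), h.weight_mapFilling F⟩⟩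

/-- An exchangeable pair of columns of `C` yields an exchange that swaps these columns in row `i`
and changes nothing above. -/
theorem exists_isExchange {j j' i : Fin n} {s t : ℕ} (hs : s ≤ i.val) (ht : i.val < t)
    (hbase : ∀ k : Fin n, s ≤ k.val → k.val < t → (k ∈ D j ↔ k ∈ D j'))
    (h : Exchangeable (D j) (D j') (C j) (C j') s t i) :
    ∃ E, IsExchange D C E (Equiv.swap j j') s t ∧ (∀ a, ∀ k < i, (k ∈ E a ↔ k ∈ C a)) ∧
      ∀ a, (i ∈ E a ↔ i ∈ C (Equiv.swap j j' a)) := by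
  classical
  let E : Diagram n := fun a => Finset.univ.filter fun i =>
    if s ≤ i.val ∧ i.val < t then i ∈ C (Equiv.swap j j' a) else i ∈ C a
  have hE : ∀ a (k : Fin n), k ∈ E a ↔
      if s ≤ k.val ∧ k.val < t then k ∈ C (Equiv.swap j j' a) else k ∈ C a := by
    intro a k
    simp [E]
  have hcases : ∀ (p : Fin n → Prop), p j → p j' → (∀ a, Equiv.swap j j' a = a → p a) →
      ∀ a, p a := by
    intro p h1 h2 h3 a
    by_cases hj : a = j
    · exact hj ▸ h1
    by_cases hj' : a = j'
    · exact hj' ▸ h2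
    · exact h3 a (Equiv.swap_apply_of_ne_of_ne hj hj')
  refine ⟨E, ⟨fun a => DFunLike.congr_fun (Equiv.swap_swap j j') a, ?_, hE, by omega, ?_, ?_⟩, ?_, ?_⟩
  · refine hcases _ ?_ ?_ ?_
    · intro k h1 h2; rw [Equiv.swap_apply_left]; exact (hbase k h1 h2).symm
    · intro k h1 h2; rw [Equiv.swap_apply_right]; exact hbase k h1 h2
    · intro a ha k _ _; rw [ha]
  · exact hcases _ (fun _ => h.left_start) (fun _ => h.right_start) fun a ha hne => absurd ha hne
  · exact hcases _ (fun _ => h.left_end) (fun _ => h.right_end) fun a ha hne => absurd ha hne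
  · intro a k hk
    rw [hE]
    split_ifs with hks
    · revert a
      refine hcases _ ?_ ?_ ?_
      · rw [Equiv.swap_apply_left]; exact (h.agree k hks.1 hk).symm
      · rw [Equiv.swap_apply_right]; exact h.agree k hks.1 hk
      · intro a ha; rw [ha]
    · rfl
  · intro a
    rw [hE, if_pos ⟨hs, ht⟩]

/-! ### Joining two diagrams with the same monomial by exchanges. -/

/-- The columns in which `C` and `C'` differ in row `i`. -/
def rowDiff (C C' : Diagram n) (i : Fin n) : Finset (Fin n) :=
  Finset.univ.filter fun a => ¬ (i ∈ C a ↔ i ∈ C' a)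

theorem rowDiff_comm (C C' : Diagram n) (i : Fin n) : rowDiff C C' i = rowDiff C' C i := by
  simp only [rowDiff, iff_comm]

theorem card_rowDiff_lt {i j j' : Fin n} (hj : i ∈ C j) (hj₂ : i ∉ E j) (hj' : i ∉ C j')
    (hj₂' : i ∈ E j') {C' : Diagram n} (h : ∀ a, (i ∈ C' a ↔ i ∈ C (Equiv.swap j j' a))) :
    (rowDiff C' E i).card < (rowDiff C E i).card := by
  refine Finset.card_lt_card (Finset.ssubset_iff_of_subset ?_ |>.2 ⟨j, ?_, ?_⟩)
  · intro a ha
    simp only [rowDiff, Finset.mem_filter, Finset.mem_univ, true_and, h] at ha ⊢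
    by_cases h1 : a = j
    · subst h1; tauto
    by_cases h2 : a = j'
    · subst h2; tauto
    rwa [Equiv.swap_apply_of_ne_of_ne h1 h2] at ha
  · simp [rowDiff, hj, hj₂]
  · simp [rowDiff, h, hj₂, hj']

theorem exists_mem_notMem_of_card_eq {ι : Type*} [Fintype ι] {p q : ι → Prop} [DecidablePred p]
    [DecidablePred q] (h : (Finset.univ.filter p).card = (Finset.univ.filter q).card)
    (hne : ∃ a, ¬ (p a ↔ q a)) : (∃ a, p a ∧ ¬ q a) ∧ ∃ a, q a ∧ ¬ p a := by
  constructor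
  · by_contra hcon
    push Not at hcon
    have := Finset.eq_of_subset_of_card_le (Finset.monotone_filter_right Finset.univ
      (fun a _ => hcon a)) h.ge
    obtain ⟨a, ha⟩ := hne
    have h2 := Finset.ext_iff.1 this a
    simp only [Finset.mem_filter, Finset.mem_univ, true_and] at h2
    exact ha h2
  · by_contra hcon
    push Not at hcon
    have := Finset.eq_of_subset_of_card_le (Finset.monotone_filter_right Finset.univ
      (fun a _ => hcon a)) h.le
    obtain ⟨a, ha⟩ := hne
    have h2 := Finset.ext_iff.1 this a
    simp only [Finset.mem_filter, Finset.mem_univ, true_and] at h2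
    exact ha h2.symm

/-- Double induction: on a bound `m` for the number of rows still to be matched, and within row `k`
on the number of columns that disagree there. Exchanges preserve the row counts and the Gale bound,
so the hypotheses persist; either diagram may be the one that changes. -/
theorem fillingsMatch_of_agree (hmf : MultiplicityFree D) (m : ℕ) :
    ∀ (k : ℕ), n ≤ k + m → ∀ (C C' : Diagram n), DiagramLE C D → DiagramLE C' D →
      (∀ i : Fin n, (Finset.univ.filter fun a => i ∈ C a).card =
        (Finset.univ.filter fun a => i ∈ C' a).card) →
      (∀ i : Fin n, i.val < k → ∀ a, (i ∈ C a ↔ i ∈ C' a)) → FillingsMatch D C C' := by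
  induction m with
  | zero =>
    intro k hk C C' _ _ _ hagree
    have : C = C' := by
      funext a
      ext i
      exact hagree i (by omega) a
    rw [this]
    exact FillingsMatch.refl _ _
  | succ m ihm =>
    intro k hk C C' hC hC' hrow hagree
    by_cases hkn : n ≤ k
    · exact ihm k (by omega) C C' hC hC' hrow hagree
    let i : Fin n := ⟨k, by omega⟩
    induction hd : (rowDiff C C' i).card using Nat.strong_induction_on generalizing C C' with
    | _ d ihd =>
    by_cases hne : ∃ a, ¬ (i ∈ C a ↔ i ∈ C' a)
    · obtain ⟨⟨j, hj, hj₂⟩, ⟨j', hj₂', hj'⟩⟩ := exists_mem_notMem_of_card_eq (hrow i) hne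
      have hjj' : j ≠ j' := by
        rintro rfl
        exact hj' hj
      have b₁ : Branch (D j) (C j) (C' j) i :=
        ⟨hC j, hC' j, fun x hx => hagree x hx j, hj, hj₂⟩
      have b₂ : Branch (D j') (C' j') (C j') i :=
        ⟨hC' j', hC j', fun x hx => (hagree x hx j').symm, hj₂', hj'⟩
      obtain ⟨s, t, hs, ht, hbase, h | h⟩ :=
        exists_exchangeable (hmf j j' hjj') (hmf j' j hjj'.symm) b₁ b₂
      · obtain ⟨E, hE, hE1, hE2⟩ := exists_isExchange (D := D) hs ht hbase h
        have hlt := card_rowDiff_lt hj hj₂ hj' hj₂' hE2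
        exact hE.fillingsMatch.trans (ihd _ (hd ▸ hlt) E C' (hE.diagramLE hC) hC'
          (fun x => (hE.card_row x).trans (hrow x))
          (fun x hx a => (hE1 a x hx).trans (hagree x hx a)) rfl)
      · obtain ⟨E, hE, hE1, hE2⟩ := exists_isExchange (D := D) hs ht hbase h
        have hlt : (rowDiff C E i).card < (rowDiff C C' i).card := by
          rw [rowDiff_comm C E, rowDiff_comm C C']
          rw [Equiv.swap_comm] at hE2
          exact card_rowDiff_lt hj₂' hj' hj₂ hj hE2
        exact (ihd _ (hd ▸ hlt) C E hC (hE.diagramLE hC')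
          (fun x => (hrow x).trans (hE.card_row x).symm)
          (fun x hx a => (hagree x hx a).trans (hE1 a x hx).symm) rfl).trans
          hE.fillingsMatch.symm
    · push Not at hne
      refine ihm (k + 1) (by omega) C C' hC hC' hrow fun x hx a => ?_
      by_cases hxk : x.val < k
      · exact hagree x hxk a
      · have : x = i := Fin.ext (by change x.val = k; omega)
        rw [this]
        exact hne a

end Fillings

/-! ### Determinants as signed sums over fillings. -/

section Leibniz

variable {n : ℕ} {D C C' : Diagram n}

theorem matrixY_of_le {i j : Fin n} (h : i ≤ j) : matrixY n i j = X ⟨(i, j), h⟩ := by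
  simp only [matrixY, Matrix.of_apply, dif_pos h]

theorem sign_eq_neg_one_pow_inversions {k : ℕ} (σ : Equiv.Perm (Fin k)) :
    ((Equiv.Perm.sign σ : ℤˣ) : ℤ) =
      (-1) ^ Nat.card {p : Fin k × Fin k // p.1 < p.2 ∧ σ p.1 > σ p.2} := by
  have hcard : Nat.card {p : Fin k × Fin k // p.1 < p.2 ∧ σ p.1 > σ p.2} =
      ∑ j, ∑ i ∈ Finset.Iio j, if σ i < σ j then 0 else 1 := by
    rw [Nat.card_eq_fintype_card, Fintype.card_subtype, Finset.card_filter,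
      Fintype.sum_prod_type, Finset.sum_comm]
    refine Finset.sum_congr rfl fun j _ => ?_
    rw [← Finset.filter_gt_eq_Iio, Finset.sum_filter]
    refine Finset.sum_congr rfl fun i _ => ?_
    by_cases hij : i < j
    · have hne : σ i ≠ σ j := fun h => hij.ne (σ.injective h)
      rcases lt_or_gt_of_ne hne with h | h
      · simp [hij, h, not_lt.2 h.le]
      · simp [hij, h, not_lt.2 h.le]
    · simp [hij]
  rw [hcard, Equiv.Perm.sign_eq_prod_prod_Iio, ← Finset.prod_pow_eq_pow_sum]
  push_cast
  refine Finset.prod_congr rfl fun j _ => ?_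
  rw [← Finset.prod_pow_eq_pow_sum]
  refine Finset.prod_congr rfl fun i _ => ?_
  split_ifs <;> simp

/-- The terms of the Leibniz expansion of `det (Y_D^C)` which do not vanish. -/
abbrev FlaggedPerms (hC : DiagramLE C D) :=
  {σ : ∀ j, Equiv.Perm (Fin (D j).card) //
    ∀ j b, (C j).orderEmbOfFin (hC j).card_eq (σ j b) ≤ (D j).orderEmbOfFin rfl b}

/-- The filling that belongs to a term of the Leibniz expansion. -/
def fillingOfPerms (hC : DiagramLE C D) (σ : FlaggedPerms hC) : FlaggedFilling D where
  entry j i := (C j).orderEmbOfFin (hC j).card_eq (σ.1 j (((D j).orderIsoOfFin rfl).symm i))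
  injective j i k h := by
    simpa using h
  flagged j i := by
    refine (σ.2 j _).trans (le_of_eq ?_)
    rw [← Finset.coe_orderIsoOfFin_apply, OrderIso.apply_symm_apply]

theorem fillingOfPerms_mem (hC : DiagramLE C D) (σ : FlaggedPerms hC) :
    fillingOfPerms hC σ ∈ fillings D C := by
  intro j
  rw [← Finset.range_orderEmbOfFin (C j) (hC j).card_eq]
  ext x
  constructor
  · rintro ⟨i, rfl⟩
    exact ⟨_, rfl⟩
  · rintro ⟨b, rfl⟩
    refine ⟨(D j).orderIsoOfFin rfl ((σ.1 j).symm b), ?_⟩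
    simp [fillingOfPerms]

theorem fillingOfPerms_bijective (hC : DiagramLE C D) : Function.Bijective
    (fun σ : FlaggedPerms hC => (⟨fillingOfPerms hC σ, fillingOfPerms_mem hC σ⟩ : fillings D C)) := by
  constructor
  · intro σ τ h
    apply Subtype.ext
    funext j
    ext b : 1
    have h1 : (fillingOfPerms hC σ).entry j ((D j).orderIsoOfFin rfl b) =
        (fillingOfPerms hC τ).entry j ((D j).orderIsoOfFin rfl b) := by
      rw [show fillingOfPerms hC σ = fillingOfPerms hC τ from congrArg Subtype.val h]
    simpa [fillingOfPerms] using h1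
  · rintro ⟨F, hF⟩
    have hmem : ∀ j (i : ↥(D j)), F.entry j i ∈ C j := fun j i => by
      rw [← Finset.mem_coe, ← hF j]
      exact ⟨i, rfl⟩
    have hbij : ∀ j, Function.Bijective
        (fun i : ↥(D j) => (⟨F.entry j i, hmem j i⟩ : ↥(C j))) := by
      intro j
      constructor
      · intro i k hik
        exact F.injective j (congrArg Subtype.val hik)
      · rintro ⟨x, hx⟩
        rw [← Finset.mem_coe, ← hF j] at hx
        obtain ⟨i, hi⟩ := hx
        exact ⟨i, Subtype.ext hi⟩
    let σ : ∀ j, Equiv.Perm (Fin (D j).card) := fun j =>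
      (((D j).orderIsoOfFin rfl).toEquiv.trans (Equiv.ofBijective _ (hbij j))).trans
        ((C j).orderIsoOfFin (hC j).card_eq).symm.toEquiv
    have hσ : ∀ j b, (C j).orderEmbOfFin (hC j).card_eq (σ j b) =
        F.entry j ((D j).orderIsoOfFin rfl b) := by
      intro j b
      rw [← Finset.coe_orderIsoOfFin_apply]
      simp [σ]
    refine ⟨⟨σ, fun j b => ?_⟩, ?_⟩
    · rw [hσ]
      exact F.flagged j _
    · apply Subtype.ext
      apply FlaggedFilling.ext
      funext j i
      change (C j).orderEmbOfFin (hC j).card_eq (σ j (((D j).orderIsoOfFin rfl).symm i)) = _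
      rw [hσ, OrderIso.apply_symm_apply]

/-- Flagged fillings correspond to the nonvanishing terms of the Leibniz expansion. -/
noncomputable def flaggedPermsEquiv (hC : DiagramLE C D) : FlaggedPerms hC ≃ fillings D C :=
  Equiv.ofBijective _ (fillingOfPerms_bijective hC)

/-- The filling is `σ` read through the increasing enumerations of `D j` and `C j`, which preserve
and reflect order. -/
theorem invColumn_fillingOfPerms (hC : DiagramLE C D) (σ : FlaggedPerms hC) (j : Fin n) :
    (fillingOfPerms hC σ).invColumn j = Nat.card
      {p : Fin (D j).card × Fin (D j).card // p.1 < p.2 ∧ σ.1 j p.1 > σ.1 j p.2} := by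
  let e := ((D j).orderIsoOfFin rfl).symm
  refine Nat.card_congr ((Equiv.prodCongr e.toEquiv e.toEquiv).subtypeEquiv ?_)
  rintro ⟨i, k⟩
  refine and_congr (e.lt_iff_lt).symm ?_
  exact ((C j).orderEmbOfFin (hC j).card_eq).lt_iff_lt

theorem sgn_fillingOfPerms (hC : DiagramLE C D) (σ : FlaggedPerms hC) :
    (fillingOfPerms hC σ).sgn = ∏ j, ((Equiv.Perm.sign (σ.1 j) : ℤˣ) : ℤ) := by
  simp only [FlaggedFilling.sgn, FlaggedFilling.inv, invColumn_fillingOfPerms,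
    sign_eq_neg_one_pow_inversions, Finset.prod_pow_eq_pow_sum]

theorem weight_fillingOfPerms (hC : DiagramLE C D) (σ : FlaggedPerms hC) :
    (fillingOfPerms hC σ).weight = ∏ j, ∏ b, matrixY n
      ((C j).orderEmbOfFin (hC j).card_eq (σ.1 j b)) ((D j).orderEmbOfFin rfl b) := by
  refine Finset.prod_congr rfl fun j _ => ?_
  refine Fintype.prod_equiv ((D j).orderIsoOfFin rfl).symm.toEquiv _ _ fun i => ?_
  have hi : (D j).orderEmbOfFin rfl (((D j).orderIsoOfFin rfl).symm i) = i.1 := by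
    rw [← Finset.coe_orderIsoOfFin_apply, OrderIso.apply_symm_apply]
  change _ = matrixY n _ ((D j).orderEmbOfFin rfl (((D j).orderIsoOfFin rfl).symm i))
  rw [hi]
  exact (matrixY_of_le ((fillingOfPerms hC σ).flagged j i)).symm

/-- The determinant as a signed sum over flagged fillings. -/
theorem detY_eq_sum (hC : DiagramLE C D) :
    detY hC = ∑ σ : FlaggedPerms hC,
      (flaggedPermsEquiv hC σ).1.sgn • (flaggedPermsEquiv hC σ).1.weight := by
  classical
  simp only [detY, columnMinor, Matrix.det_apply, Matrix.submatrix_apply]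
  rw [Fintype.prod_sum]
  have key : ∀ σ : ∀ j, Equiv.Perm (Fin (D j).card),
      ∏ j, (Equiv.Perm.sign (σ j) • ∏ b, matrixY n
        ((C j).orderEmbOfFin (hC j).card_eq (σ j b)) ((D j).orderEmbOfFin rfl b)) =
      (∏ j, ((Equiv.Perm.sign (σ j) : ℤˣ) : ℤ)) • ∏ j, ∏ b, matrixY n
        ((C j).orderEmbOfFin (hC j).card_eq (σ j b)) ((D j).orderEmbOfFin rfl b) := by
    intro σ
    simp only [Units.smul_def, zsmul_eq_mul, Finset.prod_mul_distrib, Int.cast_prod]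
  rw [Finset.sum_congr rfl fun σ _ => key σ]
  -- A term with an entry strictly below the diagonal of `Y` vanishes; the surviving ones are those
  -- that satisfy the flag condition.
  rw [← Finset.sum_filter_of_ne (p := fun σ : ∀ j, Equiv.Perm (Fin (D j).card) =>
    ∀ j b, (C j).orderEmbOfFin (hC j).card_eq (σ j b) ≤ (D j).orderEmbOfFin rfl b)]
  · rw [Finset.sum_subtype (p := fun σ : ∀ j, Equiv.Perm (Fin (D j).card) =>
      ∀ j b, (C j).orderEmbOfFin (hC j).card_eq (σ j b) ≤ (D j).orderEmbOfFin rfl b) _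
      (fun σ => by simp)]
    refine Finset.sum_congr rfl fun σ _ => ?_
    change _ = (fillingOfPerms hC σ).sgn • (fillingOfPerms hC σ).weight
    rw [sgn_fillingOfPerms, weight_fillingOfPerms]
  · intro σ _ hne j b
    by_contra hlt
    refine hne ?_
    refine smul_eq_zero_of_right _ (Finset.prod_eq_zero (Finset.mem_univ j) ?_)
    refine Finset.prod_eq_zero (Finset.mem_univ b) ?_
    simp only [matrixY, Matrix.of_apply]
    exact dif_neg hlt

theorem FillingsMatch.detY_eq (h : FillingsMatch D C C') (hC : DiagramLE C D)
    (hC' : DiagramLE C' D) : detY hC = detY hC' := by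
  obtain ⟨φ, hφ⟩ := h
  rw [detY_eq_sum, detY_eq_sum]
  refine Fintype.sum_equiv
    (((flaggedPermsEquiv hC).trans φ).trans (flaggedPermsEquiv hC').symm) _ _ fun σ => ?_
  simp only [Equiv.trans_apply, Equiv.apply_symm_apply, (hφ _).1, (hφ _).2]

theorem columnMinor_ne_zero {R S : Finset (Fin n)} (h : GaleLE R S) :
    columnMinor R S h.card_eq ≠ 0 := by
  classical
  obtain ⟨hc, hle⟩ := h
  intro h0
  -- This point turns the minor into the identity matrix. The Gale order ensures that the positions
  -- with value 1 carry variables.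
  let v : UpperIndex n → ℂ := fun p =>
    if ∃ a, R.orderEmbOfFin hc a = p.1.1 ∧ S.orderEmbOfFin rfl a = p.1.2 then 1 else 0
  have h1 := congrArg (eval v) h0
  rw [columnMinor, RingHom.map_det, map_zero] at h1
  have h2 : (eval v).mapMatrix ((matrixY n).submatrix (R.orderEmbOfFin hc)
      (S.orderEmbOfFin rfl)) = 1 := by
    ext a b
    simp only [RingHom.mapMatrix_apply, Matrix.map_apply, Matrix.submatrix_apply, matrixY,
      Matrix.of_apply]
    by_cases hab : a = b
    · subst hab
      rw [dif_pos (hle a), eval_X, Matrix.one_apply_eq]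
      exact if_pos ⟨a, rfl, rfl⟩
    · rw [Matrix.one_apply_ne hab]
      split_ifs with hr
      · rw [eval_X]
        refine if_neg ?_
        rintro ⟨c, hc1, hc2⟩
        exact hab (((R.orderEmbOfFin hc).injective hc1).symm.trans
          ((S.orderEmbOfFin rfl).injective hc2))
      · exact map_zero _
  rw [h2, Matrix.det_one] at h1
  exact one_ne_zero h1

theorem detY_ne_zero (hC : DiagramLE C D) : detY hC ≠ 0 :=
  Finset.prod_ne_zero_iff.2 fun j _ => columnMinor_ne_zero (hC j)

end Leibniz

/-! ### The torus action and the grading by rows. -/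

section Torus

variable {n : ℕ} {D C C' : Diagram n}

/-- The exponent vector of `x^C`. -/
noncomputable def rowCount (C : Diagram n) : Fin n →₀ ℕ := ∑ j, ∑ i ∈ C j, Finsupp.single i 1

theorem xMonomial_eq (C : Diagram n) : xMonomial C = monomial (rowCount C) 1 := by
  simp only [rowCount, monomial_sum_one]
  rfl

theorem xMonomial_eq_iff : xMonomial C = xMonomial C' ↔ rowCount C = rowCount C' := by
  rw [xMonomial_eq, xMonomial_eq]
  exact ⟨fun h => monomial_left_injective one_ne_zero h, fun h => by rw [h]⟩

theorem rowCount_apply (C : Diagram n) (i : Fin n) :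
    rowCount C i = (Finset.univ.filter fun a => i ∈ C a).card := by
  simp only [rowCount, Finsupp.finsetSum_apply, Finsupp.single_apply, Finset.card_filter]
  refine Finset.sum_congr rfl fun j _ => ?_
  simp

/-- The grading of `ℂ[Y]` by the rows of the variables. -/
noncomputable def rowWeight (n : ℕ) : UpperIndex n → Fin n →₀ ℕ := fun p => Finsupp.single p.1.1 1

theorem isWeightedHomogeneous_matrixY (i j : Fin n) :
    IsWeightedHomogeneous (rowWeight n) (matrixY n i j) (Finsupp.single i 1) := by
  simp only [matrixY, Matrix.of_apply]
  split_ifs with h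
  · exact isWeightedHomogeneous_X ℂ (rowWeight n) ⟨(i, j), h⟩
  · exact isWeightedHomogeneous_zero ℂ _ _

theorem isWeightedHomogeneous_columnMinor {R S : Finset (Fin n)} (h : R.card = S.card) :
    IsWeightedHomogeneous (rowWeight n) (columnMinor R S h) (∑ i ∈ R, Finsupp.single i 1) := by
  rw [columnMinor, Matrix.det_apply]
  refine IsWeightedHomogeneous.sum _ _ _ fun σ _ => ?_
  rw [Units.smul_def, ← mem_weightedHomogeneousSubmodule]
  refine zsmul_mem ?_ _
  rw [mem_weightedHomogeneousSubmodule]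
  have hsum : ∑ i ∈ R, (Finsupp.single i 1 : Fin n →₀ ℕ) =
      ∑ b, Finsupp.single (R.orderEmbOfFin h (σ b)) 1 := by
    rw [Equiv.sum_comp σ fun b => Finsupp.single (R.orderEmbOfFin h b) 1]
    conv_lhs => rw [← Finset.map_orderEmbOfFin_univ R h]
    rw [Finset.sum_map]
    rfl
  rw [hsum]
  exact IsWeightedHomogeneous.prod _ _ _ fun b _ => isWeightedHomogeneous_matrixY _ _

theorem isWeightedHomogeneous_detY (hC : DiagramLE C D) :
    IsWeightedHomogeneous (rowWeight n) (detY hC) (rowCount C) :=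
  IsWeightedHomogeneous.prod _ _ _ fun j _ => isWeightedHomogeneous_columnMinor (hC j).card_eq

/-- The inverse of the character of the torus that belongs to an exponent vector. -/
noncomputable def torusChar (r : Fin n →₀ ℕ) (x : Fin n → ℂˣ) : ℂ := ∏ i, ((x i : ℂ)⁻¹) ^ r i

theorem torusChar_zero (x : Fin n → ℂˣ) : torusChar 0 x = 1 := by
  simp [torusChar]

theorem torusChar_add (r r' : Fin n →₀ ℕ) (x : Fin n → ℂˣ) :
    torusChar (r + r') x = torusChar r x * torusChar r' x := by
  simp [torusChar, pow_add, Finset.prod_mul_distrib]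

theorem torusChar_single (i : Fin n) (k : ℕ) (x : Fin n → ℂˣ) :
    torusChar (Finsupp.single i k) x = ((x i : ℂ)⁻¹) ^ k := by
  rw [torusChar, Finset.prod_eq_single i]
  · simp
  · intro j _ hj
    simp [Finsupp.single_eq_of_ne hj]
  · simp

theorem torusChar_sum {ι : Type*} (s : Finset ι) (f : ι → Fin n →₀ ℕ) (x : Fin n → ℂˣ) :
    torusChar (∑ a ∈ s, f a) x = ∏ a ∈ s, torusChar (f a) x := by
  classical
  induction s using Finset.induction_on with
  | empty => simp [torusChar_zero]
  | insert a s ha ih => rw [Finset.sum_insert ha, Finset.prod_insert ha, torusChar_add, ih]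

theorem torusChar_injective {r r' : Fin n →₀ ℕ} (h : ∀ x, torusChar r x = torusChar r' x) :
    r = r' := by
  have key : ∀ (r : Fin n →₀ ℕ) (i : Fin n),
      -- Putting 2 in coordinate `i` and 1 elsewhere isolates the exponent `r i`.
      torusChar r (Function.update 1 i (Units.mk0 2 two_ne_zero)) = ((2 : ℂ)⁻¹) ^ r i := by
    intro r i
    rw [torusChar, Finset.prod_eq_single i]
    · simp
    · intro j _ hj
      simp [Function.update_of_ne hj]
    · simp
  ext i
  have h1 := h (Function.update 1 i (Units.mk0 2 two_ne_zero))
  rw [key, key, inv_pow, inv_pow, inv_inj] at h1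
  exact Nat.pow_right_injective le_rfl (by exact_mod_cast h1)

theorem eigenvalueOf_eq (C : Diagram n) : eigenvalueOf C = torusChar (rowCount C) := by
  funext x
  simp only [rowCount, torusChar_sum, torusChar_single, pow_one, eigenvalueOf]

theorem borelAction_diagonalGL_X (x : Fin n → ℂˣ) (p : UpperIndex n) :
    borelAction (diagonalGL x) (X p) = MvPolynomial.C ((x p.1.1 : ℂ)⁻¹) * X p := by
  rw [borelAction, aeval_X]
  have h1 : (((diagonalGL x)⁻¹ : GL (Fin n) ℂ) : Matrix (Fin n) (Fin n) ℂ) =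
      Matrix.diagonal fun i => (((x i)⁻¹ : ℂˣ) : ℂ) := rfl
  rw [h1, Matrix.diagonal_map (map_zero _), Matrix.diagonal_mul]
  simp only [matrixY, Matrix.of_apply]
  rw [dif_pos p.2, Units.val_inv_eq_inv_val]

theorem borelAction_diagonalGL_monomial (x : Fin n → ℂˣ) (e : UpperIndex n →₀ ℕ) (c : ℂ) :
    borelAction (diagonalGL x) (monomial e c) =
      monomial e (torusChar (Finsupp.weight (rowWeight n) e) x * c) := by
  have key : borelAction (diagonalGL x) (monomial e 1) =
      monomial e (torusChar (Finsupp.weight (rowWeight n) e) x) := by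
    induction e using Finsupp.induction_linear with
    | zero => simp [torusChar_zero, ← C_apply]
    | add e e' h h' =>
      rw [map_add, torusChar_add, ← monomial_mul, ← h, ← h', ← map_mul, monomial_mul, one_mul]
    | single p k =>
      rw [← X_pow_eq_monomial, map_pow, borelAction_diagonalGL_X, mul_pow, ← map_pow,
        Finsupp.weight_single, rowWeight, Finsupp.smul_single, smul_eq_mul, mul_one,
        torusChar_single, X_pow_eq_monomial, C_mul_monomial, mul_one]
  have hc : monomial e c = c • monomial e (1 : ℂ) := by simp [smul_monomial]
  rw [hc, map_smul, key, smul_monomial, smul_eq_mul, mul_comm]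

/-- The torus acts diagonally in the monomial basis, so an eigenvalue can be read off from any
nonzero coefficient of an eigenvector. -/
theorem coeff_borelAction_diagonalGL (x : Fin n → ℂˣ) (e : UpperIndex n →₀ ℕ) (f : PolyY n) :
    coeff e (borelAction (diagonalGL x) f) =
      torusChar (Finsupp.weight (rowWeight n) e) x * coeff e f := by
  induction f using MvPolynomial.induction_on' with
  | monomial u a =>
    rw [borelAction_diagonalGL_monomial, coeff_monomial, coeff_monomial]
    split_ifs with h
    · rw [h]
    · rw [mul_zero]
  | add p q hp hq => rw [map_add, coeff_add, coeff_add, hp, hq, mul_add]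

theorem mem_weylEigenspace {χ : (Fin n → ℂˣ) → ℂ} {f : PolyY n} :
    f ∈ weylEigenspace D χ ↔
      f ∈ weylModule D ∧ ∀ x, borelAction (diagonalGL x) f = χ x • f := by
  simp only [weylEigenspace, Submodule.mem_inf, Submodule.mem_iInf, Module.End.mem_eigenspace_iff,
    AlgHom.toLinearMap_apply]

theorem mem_weylEigenspace_of_isWeightedHomogeneous {f : PolyY n} {r : Fin n →₀ ℕ}
    (hf : f ∈ weylModule D) (h : IsWeightedHomogeneous (rowWeight n) f r) :
    f ∈ weylEigenspace D (torusChar r) := by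
  refine mem_weylEigenspace.2 ⟨hf, fun x => ?_⟩
  ext e
  rw [coeff_borelAction_diagonalGL, coeff_smul, smul_eq_mul]
  by_cases he : coeff e f = 0
  · rw [he, mul_zero, mul_zero]
  · rw [h he]

theorem eq_torusChar_of_mem_weylEigenspace {χ : (Fin n → ℂˣ) → ℂ} {f : PolyY n}
    (hf : f ∈ weylEigenspace D χ) {e : UpperIndex n →₀ ℕ} (he : coeff e f ≠ 0) :
    χ = torusChar (Finsupp.weight (rowWeight n) e) := by
  funext x
  have h := congrArg (coeff e) ((mem_weylEigenspace.1 hf).2 x)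
  rw [coeff_borelAction_diagonalGL, coeff_smul, smul_eq_mul] at h
  exact (mul_right_cancel₀ he h).symm

theorem weylEigenspace_eq_detSpan (D C : Diagram n) :
    weylEigenspace D (eigenvalueOf C) = detSpan D (xMonomial C) := by
  classical
  rw [eigenvalueOf_eq]
  apply le_antisymm
  · intro f hf
    have hhom : IsWeightedHomogeneous (rowWeight n) f (rowCount C) := fun e he =>
      (torusChar_injective fun x => congrFun (eq_torusChar_of_mem_weylEigenspace hf he) x).symm
    rw [← hhom.weightedHomogeneousComponent_same]
    -- An eigenvector equals its own component of degree `rowCount C`, and this projection sends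
    -- each spanning determinant to itself or to zero.
    have hmap : (weylModule D).map (weightedHomogeneousComponent (rowWeight n) (rowCount C)) ≤
        detSpan D (xMonomial C) := by
      rw [weylModule, Submodule.map_span_le]
      rintro _ ⟨C', h, rfl⟩
      rw [weightedHomogeneousComponent_of_mem (isWeightedHomogeneous_detY h)]
      split_ifs with heq
      · exact Submodule.subset_span ⟨C', h, xMonomial_eq_iff.2 heq.symm, rfl⟩
      · exact Submodule.zero_mem _
    exact hmap (Submodule.mem_map_of_mem hf.1)
  · refine Submodule.span_le.2 ?_
    rintro _ ⟨C', h, heq, rfl⟩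
    rw [xMonomial_eq_iff] at heq
    exact mem_weylEigenspace_of_isWeightedHomogeneous (Submodule.subset_span ⟨C', h, rfl⟩)
      (heq ▸ isWeightedHomogeneous_detY h)

theorem exists_eigenvalueOf_eq {χ : (Fin n → ℂˣ) → ℂ} (h : weylEigenspace D χ ≠ ⊥) :
    ∃ C, DiagramLE C D ∧ χ = eigenvalueOf C := by
  obtain ⟨f, hf, hf0⟩ := Submodule.exists_mem_ne_zero_of_ne_bot h
  obtain ⟨e, he⟩ := ne_zero_iff.1 hf0
  -- A monomial that occurs in `f` must occur in some spanning determinant, whose degree then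
  -- determines `χ`.
  have hex : ∃ C, ∃ hC : DiagramLE C D, coeff e (detY hC) ≠ 0 := by
    by_contra hcon
    push Not at hcon
    refine he ?_
    have hle : weylModule D ≤ LinearMap.ker (lcoeff ℂ e) := by
      refine Submodule.span_le.2 ?_
      rintro _ ⟨C, hC, rfl⟩
      exact hcon C hC
    exact hle hf.1
  obtain ⟨C, hC, hne⟩ := hex
  refine ⟨C, hC, ?_⟩
  rw [eq_torusChar_of_mem_weylEigenspace hf he, eigenvalueOf_eq,
    isWeightedHomogeneous_detY hC hne]

theorem fillingsMatch_of_xMonomial_eq (hmf : MultiplicityFree D) (hC : DiagramLE C D)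
    (hC' : DiagramLE C' D) (h : xMonomial C = xMonomial C') : FillingsMatch D C C' :=
  fillingsMatch_of_agree hmf n 0 (by omega) C C' hC hC'
    (fun i => by rw [← rowCount_apply, ← rowCount_apply, xMonomial_eq_iff.1 h])
    (fun i hi => absurd hi (Nat.not_lt_zero _))

theorem finrank_weylEigenspace (hmf : MultiplicityFree D) (hC : DiagramLE C D) :
    Module.finrank ℂ (weylEigenspace D (eigenvalueOf C)) = 1 := by
  have hspan : detSpan D (xMonomial C) = Submodule.span ℂ {detY hC} := by
    rw [detSpan]
    congr 1
    ext f
    constructor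
    · rintro ⟨C', hC', heq, rfl⟩
      exact (fillingsMatch_of_xMonomial_eq hmf hC' hC heq).detY_eq hC' hC
    · rintro rfl
      exact ⟨C, hC, rfl, rfl⟩
  rw [weylEigenspace_eq_detSpan, hspan, finrank_span_singleton (detY_ne_zero hC)]

end Torus

end FlaggedWeyl

theorem theorem4p1 {n : ℕ} (D : Diagram n) (hnorm : Normalized D) (hmf : MultiplicityFree D) :
    (∀ (C C' : Diagram n) (hC : DiagramLE C D) (hC' : DiagramLE C' D),
      xMonomial C = xMonomial C' →
        (∃ φ : fillings D C ≃ fillings D C',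
          ∀ F : fillings D C,
            (φ F).1.sgn = F.1.sgn ∧ (φ F).1.weight = F.1.weight) ∧
        detY hC = detY hC') ∧
    (∀ C : Diagram n, DiagramLE C D →
      weylEigenspace D (eigenvalueOf C) = detSpan D (xMonomial C) ∧
      Module.finrank ℂ (weylEigenspace D (eigenvalueOf C)) = 1) ∧
    (∀ χ : (Fin n → ℂˣ) → ℂ, weylEigenspace D χ ≠ ⊥ →
      Module.finrank ℂ (weylEigenspace D χ) = 1) := by
  refine ⟨fun C C' hC hC' h => ?_, fun C hC => ?_, fun χ hχ => ?_⟩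
  · have hm := fillingsMatch_of_xMonomial_eq hmf hC hC' h
    exact ⟨hm, hm.detY_eq hC hC'⟩
  · exact ⟨weylEigenspace_eq_detSpan D C, finrank_weylEigenspace hmf hC⟩
  · obtain ⟨C, hC, rfl⟩ := exists_eigenvalueOf_eq hχ
    exact finrank_weylEigenspace hmf hC
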